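/- Let $n,m\ge 0$ be integers, $T\in[0,\infty)$, let $f:\mathbb R^n\times\mathbb R^m\times[0,T]\to\mathbb R^n$ and $g:\mathbb R^n\times\mathbb R^m\times[0,T]\to\mathbb R^m$, and let $\mathcal Y$ be the set of continuously differentiable functions $[0,T]\to\mathbb R^m$, with $\|u\|_\infty=\sup_{t\in[0,T]}\|u(t)\|$. Assume: 1. $f(0,0,t)=0$ and $g(0,0,t)=0$ for all $t\in[0,T]$. 2. There are $\delta>0$ and a bounded open connected set $X\subset\mathbb R^n$ such that for every $\xi\in\mathbb R^n$ and $u\in\mathcal Y$ with $\|\xi\|+\|u\|_\infty<\delta$ the problem $\dot\chi(t)=f(\chi(t),u(t),t)$, $\chi(0)=\xi$, has a unique solution $\chi$ on $[0,T]$, and $\chi(t)\in X$ for all $t\in[0,T]$. 3. There is a compact set $Y\subset\mathbb R^m$ with $0$ in its interior such that $f$ and $g$ are continuously differentiable on $\overline X\times Y\times[0,T]$. The differential repetitive process (DRP) given by $f,g$ is $$\dot x_{k+1}(t)=f(x_{k+1}(t),y_k(t),t),\qquad y_{k+1}(t)=g(x_{k+1}(t),y_k(t),t),\qquad t\in[0,T],\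 k=0,1,2,\dots,$$ with boundary data $y_0\in\mathcal Y$ and $\mathbf x(0)=\{x_{k+1}(0)\}_{k\ge 0}\subset\mathbb R^n$. Its linearization is the DRP $$\dot{\bar x}_{k+1}=\bar A(t)\bar x_{k+1}+\bar B(t)\bar y_k,\qquad \bar y_{k+1}=\bar C(t)\bar x_{k+1}+\bar D(t)\bar y_k,$$ with boundary data of the same kind, where $\bar A(t)=\frac{\partial f}{\partial\chi}(0,0,t)$, $\bar B(t)=\frac{\partial f}{\partial u}(0,0,t)$, $\bar C(t)=\frac{\partial g}{\partial\chi}(0,0,t)$, $\bar D(t)=\frac{\partial g}{\partial u}(0,0,t)$. For $\lambda\in(0,1]$ put $\|\mathbf x(0)\|_{e_\lambda}=\sup_{k\ge0}\lambda^{-k}\|x_{k+1}(0)\|\in[0,\infty]$. A DRP is called * *Lyapunov stable* if for every $\varepsilon>0$ there is $\delta_1\in(0,\varepsilon)$ such that $\|y_0\|_\infty+\|\mathbf x(0)\|_{e_1}<\delta_1$ implies $\|y_k\|_\infty<\varepsilon$ for all $k$; * *asymptotically stable* if it is Lyapunov stable and there is $\delta_2>0$ such that $\|y_0\|_\infty+\|\mathbf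 x(0)\|_{e_1}<\delta_2$ and $x_{k+1}(0)\to0$ imply $\|y_k\|_\infty\to0$; * *exponentially stable* if it is asymptotically stable and there are $\delta_3>0$ and continuous nondecreasing functions $K:(0,1)\to[1,\infty)$, $\gamma:(0,1)\to(0,1)$ such that for all $\lambda\in(0,1)$, $\|y_0\|_\infty+\|\mathbf x(0)\|_{e_\lambda}<\delta_3$ implies $\|y_k\|_\infty\le K(\lambda)\gamma(\lambda)^k\big(\|y_0\|_\infty+\|\mathbf x(0)\|_{e_\lambda}\big)$ for all $k\ge 0$; * *globally exponentially stable* if this holds with $\delta_2$ and $\delta_3$ arbitrarily large (with the same $K,\gamma$). In each implication it is part of the assertion that the DRP has a solution, defined for all $k$, for the boundary data in question; the conclusion is required of every such solution. The zero-initial-state (0-i.s.) DRP is the DRP with boundary data restricted to $\mathbf x(0)=0$, with the same stability notions. **Theorem.** The following are equivalent: 1. the DRP given by $f,g$ is exponentially stable; 2. the 0-i.s. DRP given by $f,g$ is exponentially stable; 3. the linearization is globally exponentially stable; 4. the 0-i.s. linearization is globally exponentially stable; 5. $\max_{t\in[0,T]}\rho(\bar D(t))<1$ (the maximum being attained), where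 $\rho$ is the spectral radius. If $T>0$, the same five-way equivalence also holds when in (3) and (4) the linearization is considered on $L^\infty$: $y_0\in L^\infty([0,T],\mathbb R^m)$, $\|\cdot\|_\infty$ is the essential supremum norm, $\bar x_{k+1}$ is continuous and solves the integrated differential equation, and the output equation holds for almost every $t$. -/

import Mathlib

open scoped ENNReal Topology

namespace DRP

/-- `ℝ^p` with its Euclidean norm. -/
abbrev Vec (p : ℕ) : Type := EuclideanSpace ℝ (Fin p)

/-- The uniform norm `sup_{t ∈ [0,T]} ‖y t‖`, valued in `[0,∞]`. -/
noncomputable def supNorm {p : ℕ} (T : ℝ) (y : ℝ → Vec p) : ℝ≥0∞ :=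
  ⨆ t ∈ Set.Icc (0 : ℝ) T, ‖y t‖ₑ

/-- Lebesgue measure on `[0,T]`. -/
noncomputable def timeMeasure (T : ℝ) : MeasureTheory.Measure ℝ :=
  MeasureTheory.volume.restrict (Set.Icc (0 : ℝ) T)

/-- The exponential norm `sup_k lam^{-k} ‖b_{k+1}‖`, valued in `[0,∞]`; the term `b_{k+1}` of the
sequence is written `b k`. -/
noncomputable def expNorm {p : ℕ} (lam : ℝ) (b : ℕ → Vec p) : ℝ≥0∞ :=
  ⨆ k : ℕ, ENNReal.ofReal ((lam ^ k)⁻¹) * ‖b k‖ₑ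

/-- `χ` solves `χ' = f(χ, u, t)` on `[0,T]` (one-sided derivatives at the end points). -/
def IsCurve {n m : ℕ} (f : Vec n → Vec m → ℝ → Vec n) (T : ℝ) (u : ℝ → Vec m)
    (χ : ℝ → Vec n) : Prop :=
  ∀ t ∈ Set.Icc (0 : ℝ) T, HasDerivWithinAt χ (f (χ t) (u t) t) (Set.Icc (0 : ℝ) T) t

/-- A repetitive process, seen as a boundary value problem for output sequences `y_0, y_1, …`:
the admissible initial outputs `y_0`, the norm of output signals, the admissible sequences
`k ↦ x_{k+1}(0)` of initial states, and the relation
"`y` is an output sequence for the boundary data `y_0` and `k ↦ x_{k+1}(0)`". -/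
structure RepProcess (n m : ℕ) where
  signals : Set (ℝ → Vec m)
  size : (ℝ → Vec m) → ℝ≥0∞
  initials : Set (ℕ → Vec n)
  IsOutput : (ℝ → Vec m) → (ℕ → Vec n) → (ℕ → ℝ → Vec m) → Prop

namespace RepProcess

/-- The process with zero initial states. -/
def zeroInitial {n m : ℕ} (P : RepProcess n m) : RepProcess n m where
  signals := P.signals
  size := P.size
  initials := {ξ | ξ ∈ P.initials ∧ ξ = 0}
  IsOutput := P.IsOutput

/-- Lyapunov stability of the origin. Here and below, it is part of the assertion that the
process has an output sequence, defined for all passes, for all small boundary data. -/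
def LyapunovStable {n m : ℕ} (P : RepProcess n m) : Prop :=
  ∀ ε : ℝ, 0 < ε → ∃ δ₁ : ℝ, 0 < δ₁ ∧ δ₁ < ε ∧
    ∀ y₀ ∈ P.signals, ∀ ξ ∈ P.initials,
      P.size y₀ + expNorm 1 ξ < ENNReal.ofReal δ₁ →
        (∃ y, P.IsOutput y₀ ξ y) ∧
        ∀ y, P.IsOutput y₀ ξ y → ∀ k, P.size (y k) < ENNReal.ofReal ε

/-- Boundary data of size less than `δ₂`, with initial states tending to zero, give outputs that
tend to zero. -/
def AttractsWithin {n m : ℕ} (P : RepProcess n m) (δ₂ : ℝ) : Prop :=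
  ∀ y₀ ∈ P.signals, ∀ ξ ∈ P.initials,
    P.size y₀ + expNorm 1 ξ < ENNReal.ofReal δ₂ →
      Filter.Tendsto ξ Filter.atTop (𝓝 0) →
        (∃ y, P.IsOutput y₀ ξ y) ∧
        ∀ y, P.IsOutput y₀ ξ y →
          Filter.Tendsto (fun k => P.size (y k)) Filter.atTop (𝓝 0)

/-- The exponential estimate with gain `K lam` and rate `γ lam`, for boundary data of size less
than `δ₃`. -/
def ExpBoundWithin {n m : ℕ} (P : RepProcess n m) (K γ : ℝ → ℝ) (δ₃ : ℝ) : Prop :=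
  ∀ lam ∈ Set.Ioo (0 : ℝ) 1, ∀ y₀ ∈ P.signals, ∀ ξ ∈ P.initials,
    P.size y₀ + expNorm lam ξ < ENNReal.ofReal δ₃ →
      (∃ y, P.IsOutput y₀ ξ y) ∧
      ∀ y, P.IsOutput y₀ ξ y → ∀ k,
        P.size (y k) ≤ ENNReal.ofReal (K lam * γ lam ^ k) * (P.size y₀ + expNorm lam ξ)

/-- `K : (0,1) → [1,∞)` and `γ : (0,1) → (0,1)` are continuous and increasing. -/
def IsGainRate (K γ : ℝ → ℝ) : Prop :=
  Set.MapsTo K (Set.Ioo 0 1) (Set.Ici 1) ∧ ContinuousOn K (Set.Ioo 0 1) ∧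
    MonotoneOn K (Set.Ioo 0 1) ∧
  Set.MapsTo γ (Set.Ioo 0 1) (Set.Ioo 0 1) ∧ ContinuousOn γ (Set.Ioo 0 1) ∧
    MonotoneOn γ (Set.Ioo 0 1)

def AsymptoticallyStable {n m : ℕ} (P : RepProcess n m) : Prop :=
  P.LyapunovStable ∧ ∃ δ₂ : ℝ, 0 < δ₂ ∧ P.AttractsWithin δ₂

def ExponentiallyStable {n m : ℕ} (P : RepProcess n m) : Prop :=
  P.AsymptoticallyStable ∧
    ∃ δ₃ : ℝ, 0 < δ₃ ∧ ∃ K γ : ℝ → ℝ, IsGainRate K γ ∧ P.ExpBoundWithin K γ δ₃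

/-- Global asymptotic stability: `δ₂` may be taken arbitrarily large. -/
def GloballyAsymptoticallyStable {n m : ℕ} (P : RepProcess n m) : Prop :=
  P.LyapunovStable ∧ ∀ δ₂ : ℝ, 0 < δ₂ → P.AttractsWithin δ₂

/-- Global exponential stability: `δ₂` and `δ₃` may be taken arbitrarily large. -/
def GloballyExponentiallyStable {n m : ℕ} (P : RepProcess n m) : Prop :=
  P.GloballyAsymptoticallyStable ∧
    ∃ K γ : ℝ → ℝ, IsGainRate K γ ∧ ∀ δ₃ : ℝ, 0 < δ₃ → P.ExpBoundWithin K γ δ₃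

end RepProcess

/-- The differential repetitive process `x_{k+1}' = f(x_{k+1}, y_k, t)`,
`y_{k+1} = g(x_{k+1}, y_k, t)` on `[0,T]`, with continuously differentiable `y_0` and the
uniform norm. -/
noncomputable def drp {n m : ℕ} (f : Vec n → Vec m → ℝ → Vec n)
    (g : Vec n → Vec m → ℝ → Vec m) (T : ℝ) : RepProcess n m where
  signals := {y₀ | ContDiffOn ℝ 1 y₀ (Set.Icc 0 T)}
  size := supNorm T
  initials := Set.univ
  IsOutput := fun y₀ ξ y => y 0 = y₀ ∧ ∀ k, ∃ χ : ℝ → Vec n,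
    χ 0 = ξ k ∧ IsCurve f T (y k) χ ∧
      ∀ t ∈ Set.Icc (0 : ℝ) T, y (k + 1) t = g (χ t) (y k t) t

/-- The linear process `x_{k+1}' = A(t) x_{k+1} + B(t) y_k`, `y_{k+1} = C(t) x_{k+1} + D(t) y_k`
on `[0,T]` with outputs in `L^∞`: the states are continuous and solve the integrated
differential equation, and output identities hold almost everywhere. -/
noncomputable def linftyDrp {n m : ℕ} (A : ℝ → Vec n →L[ℝ] Vec n) (B : ℝ → Vec m →L[ℝ] Vec n)
    (C : ℝ → Vec n →L[ℝ] Vec m) (D : ℝ → Vec m →L[ℝ] Vec m) (T : ℝ) : RepProcess n m where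
  signals := {y₀ | MeasureTheory.MemLp y₀ ⊤ (timeMeasure T)}
  size := fun y => MeasureTheory.eLpNorm y ⊤ (timeMeasure T)
  initials := Set.univ
  IsOutput := fun y₀ ξ y => y 0 = y₀ ∧ ∀ k,
    MeasureTheory.MemLp (y k) ⊤ (timeMeasure T) ∧ ∃ χ : ℝ → Vec n,
      ContinuousOn χ (Set.Icc 0 T) ∧
      (∀ t ∈ Set.Icc (0 : ℝ) T, χ t = ξ k + ∫ s in (0 : ℝ)..t, (A s (χ s) + B s (y k s))) ∧
      ∀ᵐ t ∂(timeMeasure T), y (k + 1) t = C t (χ t) + D t (y k t)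

/-- The derivative of `h(·, 0, t)` at `0`. -/
noncomputable def partialState {n m p : ℕ} (h : Vec n → Vec m → ℝ → Vec p) (t : ℝ) :
    Vec n →L[ℝ] Vec p :=
  fderiv ℝ (fun ξ => h ξ 0 t) 0

/-- The derivative of `h(0, ·, t)` at `0`. -/
noncomputable def partialInput {n m p : ℕ} (h : Vec n → Vec m → ℝ → Vec p) (t : ℝ) :
    Vec m →L[ℝ] Vec p :=
  fderiv ℝ (fun v => h 0 v t) 0

/-- The linearization at the origin, with continuously differentiable `y_0`. -/
noncomputable def linearization {n m : ℕ} (f : Vec n → Vec m → ℝ → Vec n)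
    (g : Vec n → Vec m → ℝ → Vec m) (T : ℝ) : RepProcess n m :=
  drp (fun ξ v t => partialState f t ξ + partialInput f t v)
    (fun ξ v t => partialState g t ξ + partialInput g t v) T

/-- The linearization at the origin, with `y_0` in `L^∞`. -/
noncomputable def linftyLinearization {n m : ℕ} (f : Vec n → Vec m → ℝ → Vec n)
    (g : Vec n → Vec m → ℝ → Vec m) (T : ℝ) : RepProcess n m :=
  linftyDrp (partialState f) (partialInput f) (partialState g) (partialInput g) T

/-- The spectral radius of a real matrix, i.e. the largest modulus of a complex eigenvalue. -/
noncomputable def rho {m : ℕ} (D : Vec m →L[ℝ] Vec m) : ℝ≥0∞ :=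
  spectralRadius ℂ ((LinearMap.toMatrix (EuclideanSpace.basisFun (Fin m) ℝ).toBasis
    (EuclideanSpace.basisFun (Fin m) ℝ).toBasis (D : Vec m →ₗ[ℝ] Vec m)).map (algebraMap ℝ ℂ))

/-- `max_{t ∈ [0,T]} ρ(D t) < 1`. -/
def MaxRhoLtOne {m : ℕ} (D : ℝ → Vec m →L[ℝ] Vec m) (T : ℝ) : Prop :=
  ∃ r : ℝ≥0∞, IsGreatest ((fun t => rho (D t)) '' Set.Icc (0 : ℝ) T) r ∧ r < 1

end DRP

/-! The input enters a pass in two ways: instantaneously, through multiplication by `D(t)`, and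
through the state, which is an integral over the past. In a norm weighted by `e^{-Lt}` the integral
contribution becomes small as `L` grows, so stability is decided by the powers of `D(t)`, uniformly
in `t`.

Sufficiency of the spectral condition: Gelfand's formula and compactness of `[0,T]` give `‖D(t)^k‖ ≤
c γ^k` with common `c` and `γ < 1` (`exists_uniform_norm_pow_le`). In the adapted norm `sup_j γ^{-j}
‖D(t)^j v‖` the operator `D(t)` contracts by `γ`; for `L` large a whole pass sends size `s` to at
most `(1+γ)/2 * s + const * ‖ξ‖` (`PassConstants.output`). `Contracts` records this property, and
all stability notions follow from it by comparison with a scalar recursion. For the nonlinear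
process the estimate holds for small data, which the recursion keeps small; for linear processes it
holds at every size, and on `L^∞` it holds almost everywhere in time.

Necessity: exponential decay with zero initial states, at a single `lam`, is enough
(`ZeroStateDecay`). The input `ε v / cosh(L(t - t₀))` has its maximum at `t₀` and rises so late that
the states it creates up to time `t₀` are negligible. Hence `y_k(t₀)` is nearly `ε D(t₀)^k v`
(`norm_sub_pow_apply_le`), while decay bounds it by `K γ^k ε ‖v‖`. Sharpening the peak yields
`‖D(t₀)^k‖ ≤ K γ^k` (`ZeroStateDecay.norm_pow_le`), so `ρ(D(t₀)) ≤ γ < 1`. A linear process is its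
own linearization, so the same argument covers it. -/

namespace DRP

/-! ### Spectral radius and uniform power bounds -/

section Spectral

open Filter Set

attribute [local instance] Matrix.linftyOpNormedRing Matrix.linftyOpNormedAlgebra

/-- The complex matrix of an operator on `ℝ^m`. -/
noncomputable def complexMatrix {m : ℕ} :
    (Vec m →L[ℝ] Vec m) →ₗ[ℝ] Matrix (Fin m) (Fin m) ℂ where
  toFun D := (LinearMap.toMatrix (EuclideanSpace.basisFun (Fin m) ℝ).toBasis
    (EuclideanSpace.basisFun (Fin m) ℝ).toBasis (D : Vec m →ₗ[ℝ] Vec m)).map (algebraMap ℝ ℂ)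
  map_add' D E := by ext i j; simp
  map_smul' c D := by ext i j; simp

theorem complexMatrix_mul {m : ℕ} (D E : Vec m →L[ℝ] Vec m) :
    complexMatrix (D * E) = complexMatrix D * complexMatrix E := by
  simp only [complexMatrix, LinearMap.coe_mk, AddHom.coe_mk, ← Matrix.map_mul]
  rw [← LinearMap.toMatrix_mul]
  rfl

theorem complexMatrix_one {m : ℕ} : complexMatrix (1 : Vec m →L[ℝ] Vec m) = 1 := by
  simp only [complexMatrix, LinearMap.coe_mk, AddHom.coe_mk]
  rw [ContinuousLinearMap.toLinearMap_one, LinearMap.toMatrix_one]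
  simp

theorem complexMatrix_pow {m : ℕ} (D : Vec m →L[ℝ] Vec m) (k : ℕ) :
    complexMatrix (D ^ k) = complexMatrix D ^ k := by
  induction k with
  | zero => simp [complexMatrix_one]
  | succ k ih => rw [pow_succ, complexMatrix_mul, ih, pow_succ]

theorem complexMatrix_injective {m : ℕ} : Function.Injective (complexMatrix (m := m)) := by
  intro D E h
  simp only [complexMatrix, LinearMap.coe_mk, AddHom.coe_mk] at h
  have h1 := Matrix.map_injective (algebraMap ℝ ℂ).injective h
  exact ContinuousLinearMap.coe_injective ((LinearMap.toMatrix _ _).injective h1)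

theorem continuous_complexMatrix {m : ℕ} : Continuous (complexMatrix (m := m)) :=
  LinearMap.continuous_of_finiteDimensional _

theorem exists_norm_complexMatrix_le {m : ℕ} :
    ∃ C : ℝ, 0 < C ∧ ∀ D : Vec m →L[ℝ] Vec m, ‖complexMatrix D‖ ≤ C * ‖D‖ := by
  obtain ⟨C, hC, h⟩ := (LinearMap.toContinuousLinearMap (complexMatrix (m := m))).bound
  exact ⟨C, hC, h⟩

theorem exists_norm_le_complexMatrix {m : ℕ} :
    ∃ C : ℝ, 0 < C ∧ ∀ D : Vec m →L[ℝ] Vec m, ‖D‖ ≤ C * ‖complexMatrix D‖ := by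
  obtain ⟨C, hC, h⟩ := (complexMatrix (m := m)).exists_antilipschitzWith
    (LinearMap.ker_eq_bot.2 complexMatrix_injective)
  refine ⟨C, hC, fun D => ?_⟩
  simpa using h.le_mul_dist D 0

/-- Gelfand's formula: the `k`-th root of `K' γ^k` tends to `γ`. -/
theorem rho_le_of_norm_pow_le {m : ℕ} {D : Vec m →L[ℝ] Vec m} {K γ : ℝ} (hγ : 0 ≤ γ)
    (h : ∀ k, ‖D ^ k‖ ≤ K * γ ^ k) : rho D ≤ ENNReal.ofReal γ := by
  obtain ⟨C, hC, hCD⟩ := exists_norm_complexMatrix_le (m := m)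
  -- The maximum with `1` makes the constant positive, so that its `k`-th roots tend to `1`.
  set K' := max 1 (C * K)
  have hK' : 0 < K' := lt_of_lt_of_le one_pos (le_max_left _ _)
  have hle : ∀ k, ‖complexMatrix D ^ k‖ ≤ K' * γ ^ k := fun k => by
    rw [← complexMatrix_pow]
    calc _ ≤ C * ‖D ^ k‖ := hCD _
      _ ≤ C * (K * γ ^ k) := by gcongr; exact h k
      _ = C * K * γ ^ k := by ring
      _ ≤ K' * γ ^ k := by gcongr; exact le_max_right _ _
  have h1 := spectrum.pow_norm_pow_one_div_tendsto_nhds_spectralRadius (complexMatrix D)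
  have h2 : Tendsto (fun k : ℕ => ENNReal.ofReal (K' ^ (1 / k : ℝ) * γ)) atTop
      (𝓝 (ENNReal.ofReal (K' ^ (0 : ℝ) * γ))) := by
    apply ENNReal.tendsto_ofReal
    apply Tendsto.mul_const
    exact ((Real.continuous_const_rpow hK'.ne').tendsto 0).comp tendsto_one_div_atTop_nhds_zero_nat
  rw [Real.rpow_zero, one_mul] at h2
  refine le_of_tendsto_of_tendsto h1 h2 ?_
  filter_upwards [eventually_ge_atTop 1] with k hk
  apply ENNReal.ofReal_le_ofReal
  have hk' : k ≠ 0 := by omega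
  calc ‖complexMatrix D ^ k‖ ^ (1 / k : ℝ) ≤ (K' * γ ^ k) ^ (1 / k : ℝ) := by
        gcongr; exact hle k
    _ = K' ^ (1 / k : ℝ) * γ := by
        rw [Real.mul_rpow hK'.le (by positivity), one_div, Real.pow_rpow_inv_natCast hγ hk']

/-- Gelfand's formula again: for `q` between `ρ(D)` and `1` the `k`-th power is eventually below `C
q^k`, where `C` compares the operator norm with the matrix norm. -/
theorem exists_norm_pow_lt_of_rho_lt_one {m : ℕ} {D : Vec m →L[ℝ] Vec m} (h : rho D < 1) :
    ∃ N : ℕ, 1 ≤ N ∧ ‖D ^ N‖ < 1 / 2 := by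
  obtain ⟨C, hC, hCD⟩ := exists_norm_le_complexMatrix (m := m)
  obtain ⟨q, hq, hq1⟩ := ENNReal.lt_iff_exists_nnreal_btwn.1 h
  have hq1' : (q : ℝ) < 1 := by exact_mod_cast hq1
  have h1 := (spectrum.pow_norm_pow_one_div_tendsto_nhds_spectralRadius
    (complexMatrix D)).eventually_lt_const hq
  have h2 : Tendsto (fun k : ℕ => C * (q : ℝ) ^ k) atTop (𝓝 (C * 0)) :=
    (tendsto_pow_atTop_nhds_zero_of_lt_one q.2 hq1').const_mul C
  rw [mul_zero] at h2
  obtain ⟨k, hk, hk2, hk1⟩ := (h1.and ((h2.eventually_lt_const (u := (1 / 2 : ℝ))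
    (by norm_num)).and (eventually_ge_atTop 1))).exists
  refine ⟨k, hk1, lt_of_le_of_lt ?_ hk2⟩
  have hk' : k ≠ 0 := by omega
  refine (hCD _).trans ?_
  rw [complexMatrix_pow]
  gcongr
  have h3 : ‖complexMatrix D ^ k‖ ^ (1 / k : ℝ) < q := by
    rw [← ENNReal.ofReal_coe_nnreal] at hk
    exact (ENNReal.ofReal_lt_ofReal_iff' .. |>.1 hk).1
  calc ‖complexMatrix D ^ k‖ = (‖complexMatrix D ^ k‖ ^ (1 / k : ℝ)) ^ k := by
        rw [one_div, Real.rpow_inv_natCast_pow (norm_nonneg _) hk']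
    _ ≤ (q : ℝ) ^ k := by gcongr

/-- The spectrum is upper hemicontinuous, so it stays inside an open disc under small perturbations.
Upper semicontinuity suffices for the maximum over a compact set to be attained. -/
theorem upperSemicontinuous_rho {m : ℕ} : UpperSemicontinuous (rho (m := m)) := by
  intro D c hc
  obtain ⟨q, hq, hqc⟩ := ENNReal.lt_iff_exists_nnreal_btwn.1 hc
  have h1 := (upperHemicontinuous_iff_forall_isOpen.1
    (upperHemicontinuous_spectrum ℂ (Matrix (Fin m) (Fin m) ℂ))) (complexMatrix D)
    {z | ‖z‖₊ < q} (isOpen_lt continuous_nnnorm continuous_const) (fun z hz => by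
      have := (le_iSup₂ (f := fun z (_ : z ∈ spectrum ℂ (complexMatrix D)) => (‖z‖₊ : ℝ≥0∞))
        z hz).trans_lt hq
      exact_mod_cast this)
  filter_upwards [continuous_complexMatrix.continuousAt.eventually h1] with E hE
  refine lt_of_le_of_lt (iSup₂_le fun z hz => ?_) hqc
  exact_mod_cast (le_of_lt (hE hz : ‖z‖₊ < q))

theorem exists_isGreatest_rho {m : ℕ} {D : ℝ → Vec m →L[ℝ] Vec m} {s : Set ℝ} (hs : IsCompact s)
    (hne : s.Nonempty) (hD : ContinuousOn D s) :
    ∃ t ∈ s, IsGreatest ((fun t => rho (D t)) '' s) (rho (D t)) := by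
  have h : UpperSemicontinuousOn (fun t => rho (D t)) s := fun t ht c hc =>
    (hD t ht).eventually (upperSemicontinuous_rho (D t) c hc)
  obtain ⟨t, ht, hmax⟩ := h.exists_isMaxOn hne hs
  exact ⟨t, ht, mem_image_of_mem _ ht, by rintro _ ⟨t', ht', rfl⟩; exact hmax ht'⟩

/-- Peeling off blocks of `N` factors costs `θ^N` each; the remaining fewer than `N` factors account
for the constant `(M / θ)^N`. -/
theorem norm_pow_le_of_norm_pow_le {m : ℕ} {D : Vec m →L[ℝ] Vec m} {N : ℕ} {θ M : ℝ} (hN : 1 ≤ N)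
    (hθ : 0 < θ) (hθ1 : θ ≤ 1) (hM : 1 ≤ M) (hD : ‖D‖ ≤ M) (hDN : ‖D ^ N‖ ≤ θ ^ N) (k : ℕ) :
    ‖D ^ k‖ ≤ (M / θ) ^ N * θ ^ k := by
  have h1 : 1 ≤ M / θ := by rw [le_div_iff₀ hθ]; linarith
  induction k using Nat.strong_induction_on with
  | _ k ih =>
    rcases lt_or_ge k N with hk | hk
    · have h2 : ‖D ^ k‖ ≤ M ^ k := by
        rcases k.eq_zero_or_pos with rfl | h0
        · rw [pow_zero, pow_zero]; exact ContinuousLinearMap.norm_id_le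
        · exact (norm_pow_le' D h0).trans (by gcongr)
      calc ‖D ^ k‖ ≤ M ^ k := h2
        _ = (M / θ) ^ k * θ ^ k := by rw [← mul_pow, div_mul_cancel₀ _ hθ.ne']
        _ ≤ (M / θ) ^ N * θ ^ k := by gcongr
    · obtain ⟨j, rfl⟩ := Nat.exists_eq_add_of_le hk
      calc ‖D ^ (N + j)‖ ≤ ‖D ^ N‖ * ‖D ^ j‖ := by rw [pow_add]; exact norm_mul_le _ _
        _ ≤ θ ^ N * ((M / θ) ^ N * θ ^ j) := by gcongr; exact ih j (by omega)
        _ = _ := by ring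

/-- The condition `‖D(t)^N‖ < 1/2` is open in `t`, so one exponent `N` serves a neighbourhood.
Bounds with constants `c, γ` pass to finite unions by taking maxima, and compactness concludes. -/
theorem exists_uniform_norm_pow_le {m : ℕ} {D : ℝ → Vec m →L[ℝ] Vec m} {s : Set ℝ}
    (hs : IsCompact s) (hD : ContinuousOn D s) (h : ∀ t ∈ s, rho (D t) < 1) :
    ∃ c γ : ℝ, 1 ≤ c ∧ 0 < γ ∧ γ < 1 ∧ ∀ t ∈ s, ∀ k, ‖D t ^ k‖ ≤ c * γ ^ k := by
  refine hs.induction_on (p := fun S => ∃ c γ : ℝ, 1 ≤ c ∧ 0 < γ ∧ γ < 1 ∧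
    ∀ t ∈ S, ∀ k, ‖D t ^ k‖ ≤ c * γ ^ k) ⟨1, 1 / 2, le_rfl, by norm_num, by norm_num, by simp⟩
    ?_ ?_ ?_
  · rintro S S' hSS ⟨c, γ, hc, hγ, hγ1, hb⟩
    exact ⟨c, γ, hc, hγ, hγ1, fun t ht => hb t (hSS ht)⟩
  · rintro S S' ⟨c, γ, hc, hγ, hγ1, hb⟩ ⟨c', γ', hc', hγ', hγ1', hb'⟩
    refine ⟨max c c', max γ γ', le_max_of_le_left hc, lt_max_of_lt_left hγ, max_lt hγ1 hγ1', ?_⟩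
    rintro t (ht | ht) k
    · exact (hb t ht k).trans (by gcongr <;> exact le_max_left _ _)
    · exact (hb' t ht k).trans (by gcongr <;> exact le_max_right _ _)
  · intro t ht
    obtain ⟨N, hN, hDN⟩ := exists_norm_pow_lt_of_rho_lt_one (h t ht)
    have e1 := ((hD t ht).pow N).norm.eventually (gt_mem_nhds hDN)
    have e2 := (hD t ht).norm.eventually (gt_mem_nhds (lt_add_one ‖D t‖))
    -- The `N`-th root of `1/2`, so that the local bound reads `‖D^N‖ ≤ θ^N`.
    set θ : ℝ := (1 / 2) ^ (1 / N : ℝ)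
    have hN' : N ≠ 0 := by omega
    have hθN : θ ^ N = 1 / 2 := by
      simp only [θ, one_div]; exact Real.rpow_inv_natCast_pow (by norm_num) hN'
    have hθ : 0 < θ := by positivity
    have hθ1 : θ < 1 := Real.rpow_lt_one (by norm_num) (by norm_num) (by positivity)
    have hM : 1 ≤ ‖D t‖ + 1 := by linarith [norm_nonneg (D t)]
    refine ⟨_, e1.and e2, ((‖D t‖ + 1) / θ) ^ N, θ, one_le_pow₀ ?_, hθ, hθ1, ?_⟩
    · rw [le_div_iff₀ hθ]; linarith
    · rintro t' ⟨h1, h2⟩ k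
      exact norm_pow_le_of_norm_pow_le hN hθ hθ1.le hM (le_of_lt h2)
        ((le_of_lt h1).trans_eq hθN.symm) k

end Spectral

/-! ### From a one-pass contraction to the stability notions -/

section Comparison

open Filter Set

/-- The comparison sequence `s_{k+1} = γ s_k + K ‖ξ_k‖`. -/
noncomputable def gaugeSeq {n : ℕ} (γ K s₀ : ℝ) (ξ : ℕ → Vec n) : ℕ → ℝ
  | 0 => s₀
  | k + 1 => γ * gaugeSeq γ K s₀ ξ k + K * ‖ξ k‖

theorem gaugeSeq_nonneg {n : ℕ} {γ K s₀ : ℝ} (hγ : 0 ≤ γ) (hK : 0 ≤ K) (hs : 0 ≤ s₀)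
    (ξ : ℕ → Vec n) (k : ℕ) : 0 ≤ gaugeSeq γ K s₀ ξ k := by
  induction k with
  | zero => exact hs
  | succ k ih => simp only [gaugeSeq]; positivity

/-- With `M = c + 2K/(1-γ)` and `θ - γ ≥ (1-γ)/2` one has `γ M + K ≤ M θ`, which makes `M θ^k (σ +
E)` a supersolution of the recursion. -/
theorem gaugeSeq_le {n : ℕ} {γ K c σ E θ : ℝ} (hγ : 0 ≤ γ) (hγ1 : γ < 1) (hK : 0 ≤ K) (hc : 0 ≤ c)
    (hσ : 0 ≤ σ) (hE : 0 ≤ E) (hθ : (1 + γ) / 2 ≤ θ) {ξ : ℕ → Vec n}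
    (hξ : ∀ k, ‖ξ k‖ ≤ θ ^ k * E) (k : ℕ) :
    gaugeSeq γ K (c * σ) ξ k ≤ (c + 2 * K / (1 - γ)) * θ ^ k * (σ + E) := by
  have h1 : 0 < 1 - γ := by linarith
  have h2 : 0 ≤ 2 * K / (1 - γ) := by positivity
  have hθ0 : 0 ≤ θ := by linarith
  set M := c + 2 * K / (1 - γ)
  have hM : γ * M + K ≤ M * θ := by
    have h3 : 2 * K / (1 - γ) * (1 - γ) = 2 * K := div_mul_cancel₀ _ h1.ne'
    have h4 : 2 * K ≤ M * (1 - γ) := by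
      simp only [M, add_mul]; nlinarith
    nlinarith [mul_le_mul_of_nonneg_left hθ (by positivity : 0 ≤ M)]
  induction k with
  | zero =>
    simp only [gaugeSeq, pow_zero, mul_one, M]
    nlinarith [mul_nonneg h2 hσ, mul_nonneg h2 hE, mul_nonneg hc hE]
  | succ k ih =>
    have hp : 0 ≤ θ ^ k * (σ + E) := by positivity
    calc gaugeSeq γ K (c * σ) ξ (k + 1)
        = γ * gaugeSeq γ K (c * σ) ξ k + K * ‖ξ k‖ := rfl
      _ ≤ γ * (M * θ ^ k * (σ + E)) + K * (θ ^ k * (σ + E)) := by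
          gcongr
          exact (hξ k).trans (by gcongr; linarith)
      _ = (γ * M + K) * (θ ^ k * (σ + E)) := by ring
      _ ≤ M * θ * (θ ^ k * (σ + E)) := by gcongr
      _ = M * θ ^ (k + 1) * (σ + E) := by ring

/-- Once the forcing is below `(ε/2)(1-γ)`, the recursion relaxes geometrically towards at most the
fixed point `ε/2`. -/
theorem tendsto_gaugeSeq {n : ℕ} {γ K s₀ : ℝ} (hγ : 0 ≤ γ) (hγ1 : γ < 1) (hK : 0 ≤ K)
    (hs : 0 ≤ s₀) {ξ : ℕ → Vec n} (hξ : Tendsto ξ atTop (𝓝 0)) :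
    Tendsto (gaugeSeq γ K s₀ ξ) atTop (𝓝 0) := by
  have h1 : 0 < 1 - γ := by linarith
  rw [Metric.tendsto_atTop]
  intro ε hε
  have h2 : Tendsto (fun k => K * ‖ξ k‖) atTop (𝓝 (K * 0)) := by
    simpa using (hξ.norm).const_mul K
  rw [mul_zero] at h2
  obtain ⟨N, hN⟩ := eventually_atTop.1
    (h2.eventually_le_const (show 0 < ε / 2 * (1 - γ) by positivity))
  have h3 : ∀ j, gaugeSeq γ K s₀ ξ (N + j) ≤ γ ^ j * gaugeSeq γ K s₀ ξ N + ε / 2 := by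
    intro j
    induction j with
    | zero => simp; positivity
    | succ j ih =>
      have := hN (N + j) (by omega)
      calc gaugeSeq γ K s₀ ξ (N + (j + 1))
          = γ * gaugeSeq γ K s₀ ξ (N + j) + K * ‖ξ (N + j)‖ := rfl
        _ ≤ γ * (γ ^ j * gaugeSeq γ K s₀ ξ N + ε / 2) + ε / 2 * (1 - γ) := by gcongr
        _ = _ := by ring
  have h4 : Tendsto (fun j => γ ^ j * gaugeSeq γ K s₀ ξ N) atTop
      (𝓝 (0 * gaugeSeq γ K s₀ ξ N)) :=
    (tendsto_pow_atTop_nhds_zero_of_lt_one hγ hγ1).mul_const _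
  rw [zero_mul] at h4
  obtain ⟨J, hJ⟩ := eventually_atTop.1 (h4.eventually_lt_const (show 0 < ε / 2 by positivity))
  refine ⟨N + J, fun k hk => ?_⟩
  obtain ⟨j, rfl⟩ := Nat.exists_eq_add_of_le (show N ≤ k by omega)
  rw [Real.dist_eq, sub_zero, abs_of_nonneg (gaugeSeq_nonneg hγ hK hs ξ _)]
  linarith [h3 j, hJ j (by omega)]

/-- If every admissible pass can be continued and preserves an invariant, then output sequences
exist, and all of them satisfy the invariant. -/
theorem exists_seq_and_forall_of_step {α : Type*} (R : ℕ → α → α → Prop) (I : ℕ → α → Prop)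
    {y₀ : α} (h0 : I 0 y₀) (h : ∀ k u, I k u → (∃ v, R k u v) ∧ ∀ v, R k u v → I (k + 1) v) :
    (∃ y : ℕ → α, y 0 = y₀ ∧ ∀ k, R k (y k) (y (k + 1))) ∧
      ∀ y : ℕ → α, y 0 = y₀ → (∀ k, R k (y k) (y (k + 1))) → ∀ k, I k (y k) := by
  refine ⟨?_, fun y hy0 hy k => ?_⟩
  -- A continuation is available only where the invariant holds, so the recursion runs in the
  -- subtype.
  · choose v hv using fun k u (hu : I k u) => (h k u hu).1
    let z : ∀ k, {u // I k u} := fun k =>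
      Nat.rec ⟨y₀, h0⟩ (fun k u => ⟨v k u.1 u.2, (h k u.1 u.2).2 _ (hv k u.1 u.2)⟩) k
    exact ⟨fun k => (z k).1, rfl, fun k => hv k (z k).1 (z k).2⟩
  · induction k with
    | zero => exact hy0 ▸ h0
    | succ k ih => exact (h k _ ih).2 _ (hy k)

/-- The pass relation `R` of the process `P` contracts the gauge `G`, as long as the gauge and the
initial states are at most `r`. -/
structure Contracts {n m : ℕ} (P : RepProcess n m)
    (R : Vec n → (ℝ → Vec m) → (ℝ → Vec m) → Prop) (G : ℝ → (ℝ → Vec m) → Prop)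
    (c γ K r : ℝ) : Prop where
  isOutput_iff : ∀ y₀ ξ y, P.IsOutput y₀ ξ y ↔ y 0 = y₀ ∧ ∀ k, R (ξ k) (y k) (y (k + 1))
  size_le : ∀ s u, G s u → P.size u ≤ ENNReal.ofReal s
  initial : ∀ u ∈ P.signals, ∀ σ, 0 ≤ σ → P.size u ≤ ENNReal.ofReal σ → G (c * σ) u
  step : ∀ ξ s u, 0 ≤ s → s ≤ r → ‖ξ‖ ≤ r → G s u →
    (∃ v, R ξ u v) ∧ ∀ v, R ξ u v → G (γ * s + K * ‖ξ‖) v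

theorem norm_le_of_expNorm_le {n : ℕ} {lam E : ℝ} (hlam : 0 < lam) (hE : 0 ≤ E) {ξ : ℕ → Vec n}
    (h : expNorm lam ξ ≤ ENNReal.ofReal E) (k : ℕ) : ‖ξ k‖ ≤ lam ^ k * E := by
  have h1 := (le_iSup (fun k => ENNReal.ofReal ((lam ^ k)⁻¹) * ‖ξ k‖ₑ) k).trans h
  rw [← ofReal_norm, ← ENNReal.ofReal_mul (by positivity),
    ENNReal.ofReal_le_ofReal_iff hE] at h1
  rwa [inv_mul_le_iff₀ (by positivity)] at h1

theorem exists_ofReal_of_add_lt {a b : ℝ≥0∞} {δ : ℝ} (h : a + b < ENNReal.ofReal δ) :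
    ∃ σ E : ℝ, 0 ≤ σ ∧ 0 ≤ E ∧ a = ENNReal.ofReal σ ∧ b = ENNReal.ofReal E ∧ σ + E < δ := by
  have hne := (h.trans_le le_top).ne
  obtain ⟨ha, hb⟩ := ENNReal.add_ne_top.1 hne
  refine ⟨a.toReal, b.toReal, ENNReal.toReal_nonneg, ENNReal.toReal_nonneg,
    (ENNReal.ofReal_toReal ha).symm, (ENNReal.ofReal_toReal hb).symm, ?_⟩
  rw [← ENNReal.toReal_add ha hb]
  exact (ENNReal.lt_ofReal_iff_toReal_lt hne).1 h

namespace Contracts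

variable {n m : ℕ} {P : RepProcess n m} {R : Vec n → (ℝ → Vec m) → (ℝ → Vec m) → Prop}
  {G : ℝ → (ℝ → Vec m) → Prop} {c γ K r : ℝ}

/-- The comparison sequence dominates the gauge of each pass; `hr` keeps that sequence and the
initial states at most `r`, so the contraction applies at every pass. -/
theorem outputs (H : Contracts P R G c γ K r) (hγ : 0 ≤ γ) (hγ1 : γ < 1) (hK : 0 ≤ K) (hc : 1 ≤ c)
    {σ E θ : ℝ} (hσ : 0 ≤ σ) (hE : 0 ≤ E) (hθ : (1 + γ) / 2 ≤ θ) (hθ1 : θ ≤ 1)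
    {y₀ : ℝ → Vec m} (hy₀ : y₀ ∈ P.signals) (hsize : P.size y₀ ≤ ENNReal.ofReal σ)
    {ξ : ℕ → Vec n} (hξ : ∀ k, ‖ξ k‖ ≤ θ ^ k * E)
    (hr : (c + 2 * K / (1 - γ)) * (σ + E) ≤ r) :
    (∃ y, P.IsOutput y₀ ξ y) ∧ ∀ y, P.IsOutput y₀ ξ y →
      ∀ k, P.size (y k) ≤ ENNReal.ofReal (gaugeSeq γ K (c * σ) ξ k) := by
  have h1 : 0 < 1 - γ := by linarith
  have h2 : 0 ≤ 2 * K / (1 - γ) := by positivity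
  have hθ0 : 0 ≤ θ := by linarith
  have hs0 : 0 ≤ c * σ := by positivity
  have hp : ∀ k, θ ^ k ≤ 1 := fun k => pow_le_one₀ hθ0 hθ1
  have key := exists_seq_and_forall_of_step (fun k => R (ξ k))
    (fun k => G (gaugeSeq γ K (c * σ) ξ k)) (H.initial y₀ hy₀ σ hσ hsize) (fun k u hu =>
      H.step (ξ k) _ u (gaugeSeq_nonneg hγ hK hs0 ξ k)
        ((gaugeSeq_le hγ hγ1 hK (by linarith) hσ hE hθ hξ k).trans (le_trans (by
          have := mul_le_mul_of_nonneg_left (hp k)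
            (by positivity : 0 ≤ (c + 2 * K / (1 - γ)) * (σ + E))
          linarith) hr))
        ((hξ k).trans (le_trans (by
          have := mul_le_mul_of_nonneg_right (hp k) hE
          nlinarith [mul_nonneg h2 hσ, mul_nonneg h2 hE]) hr)) hu)
  simp only [H.isOutput_iff]
  exact ⟨key.1, fun y hy k => H.size_le _ _ (key.2 y hy.1 hy.2 k)⟩

/-- The gain of a contracting process. -/
theorem one_le_gain (hγ1 : γ < 1) (hK : 0 ≤ K) (hc : 1 ≤ c) : 1 ≤ c + 2 * K / (1 - γ) := by
  have h1 : 0 < 1 - γ := by linarith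
  have h2 : 0 ≤ 2 * K / (1 - γ) := by positivity
  linarith

theorem lyapunovStable (H : Contracts P R G c γ K r) (hγ : 0 ≤ γ) (hγ1 : γ < 1) (hK : 0 ≤ K)
    (hc : 1 ≤ c) (hr : 0 < r) : P.LyapunovStable := by
  intro ε hε
  have hM := one_le_gain hγ1 hK hc
  set M := c + 2 * K / (1 - γ) with hMdef
  -- The bound by `r` keeps the contraction applicable; `ε / 2` gives the strict inequalities.
  refine ⟨min r (ε / 2) / M, by positivity, ?_, ?_⟩
  · calc min r (ε / 2) / M ≤ min r (ε / 2) := div_le_self (by positivity) hM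
      _ ≤ ε / 2 := min_le_right _ _
      _ < ε := by linarith
  · intro y₀ hy₀ ξ _ hlt
    obtain ⟨σ, E, hσ, hE, h1, h2, h3⟩ := exists_ofReal_of_add_lt hlt
    rw [lt_div_iff₀ (by positivity), mul_comm] at h3
    have hξ : ∀ k, ‖ξ k‖ ≤ 1 ^ k * E := norm_le_of_expNorm_le one_pos hE h2.le
    obtain ⟨h4, h5⟩ := H.outputs hγ hγ1 hK hc hσ hE (θ := 1) (by linarith) le_rfl hy₀ h1.le hξ
      (h3.le.trans (min_le_left _ _))
    refine ⟨h4, fun y hy k => (h5 y hy k).trans_lt ((ENNReal.ofReal_lt_ofReal_iff hε).2 ?_)⟩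
    have h6 := gaugeSeq_le (c := c) hγ hγ1 hK (by linarith) hσ hE (θ := 1) (by linarith) hξ k
    rw [one_pow, mul_one] at h6
    have := min_le_right r (ε / 2)
    linarith

theorem attractsWithin (H : Contracts P R G c γ K r) (hγ : 0 ≤ γ) (hγ1 : γ < 1) (hK : 0 ≤ K)
    (hc : 1 ≤ c) : P.AttractsWithin (r / (c + 2 * K / (1 - γ))) := by
  intro y₀ hy₀ ξ _ hlt hξ0
  have hM := one_le_gain hγ1 hK hc
  obtain ⟨σ, E, hσ, hE, h1, h2, h3⟩ := exists_ofReal_of_add_lt hlt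
  rw [lt_div_iff₀ (by positivity), mul_comm] at h3
  have hξ : ∀ k, ‖ξ k‖ ≤ 1 ^ k * E := norm_le_of_expNorm_le one_pos hE h2.le
  obtain ⟨h4, h5⟩ := H.outputs hγ hγ1 hK hc hσ hE (θ := 1) (by linarith) le_rfl hy₀ h1.le hξ h3.le
  refine ⟨h4, fun y hy => ?_⟩
  have h6 := ENNReal.tendsto_ofReal
    (tendsto_gaugeSeq hγ hγ1 hK (show 0 ≤ c * σ by positivity) hξ0)
  rw [ENNReal.ofReal_zero] at h6
  exact tendsto_of_tendsto_of_tendsto_of_le_of_le tendsto_const_nhds h6 (fun _ => zero_le)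
    (h5 y hy)

/-- The rate `(1 + max γ lam) / 2` is at least `(1 + γ) / 2`, as the comparison requires, and at
least `lam`, so it dominates the decay of the initial states. The gain does not depend on `lam`. -/
theorem expBoundWithin (H : Contracts P R G c γ K r) (hγ : 0 ≤ γ) (hγ1 : γ < 1) (hK : 0 ≤ K)
    (hc : 1 ≤ c) : P.ExpBoundWithin (fun _ => c + 2 * K / (1 - γ))
      (fun lam => (1 + max γ lam) / 2) (r / (c + 2 * K / (1 - γ))) := by
  intro lam hlam y₀ hy₀ ξ _ hlt
  have hM := one_le_gain hγ1 hK hc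
  obtain ⟨σ, E, hσ, hE, h1, h2, h3⟩ := exists_ofReal_of_add_lt hlt
  rw [lt_div_iff₀ (by positivity), mul_comm] at h3
  have hmax : max γ lam < 1 := max_lt hγ1 hlam.2
  set θ := (1 + max γ lam) / 2 with hθ
  have hθγ : (1 + γ) / 2 ≤ θ := by have := le_max_left γ lam; linarith
  have hθl : lam ≤ θ := by have := le_max_right γ lam; have := hlam.2; linarith
  have hlam0 : 0 ≤ lam := hlam.1.le
  have hξ : ∀ k, ‖ξ k‖ ≤ θ ^ k * E := fun k =>
    (norm_le_of_expNorm_le hlam.1 hE h2.le k).trans (by gcongr)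
  obtain ⟨h4, h5⟩ := H.outputs hγ hγ1 hK hc hσ hE hθγ (by linarith) hy₀ h1.le hξ h3.le
  refine ⟨h4, fun y hy k => (h5 y hy k).trans ?_⟩
  have hθ0 : 0 ≤ θ := hlam0.trans hθl
  rw [h1, h2, ← ENNReal.ofReal_add hσ hE, ← ENNReal.ofReal_mul (by positivity)]
  exact ENNReal.ofReal_le_ofReal (gaugeSeq_le hγ hγ1 hK (by linarith) hσ hE hθγ hξ k)

theorem isGainRate (hγ : 0 ≤ γ) (hγ1 : γ < 1) (hK : 0 ≤ K) (hc : 1 ≤ c) :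
    RepProcess.IsGainRate (fun _ => c + 2 * K / (1 - γ)) (fun lam => (1 + max γ lam) / 2) := by
  refine ⟨fun _ _ => one_le_gain hγ1 hK hc, continuousOn_const, monotoneOn_const, ?_,
    by fun_prop, ?_⟩
  · intro lam hlam
    have h1 := max_lt hγ1 hlam.2
    have h2 := le_max_left γ lam
    constructor <;> linarith
  · intro a _ b _ hab
    have := max_le_max_left γ hab
    simp only
    linarith

theorem exponentiallyStable (H : Contracts P R G c γ K r) (hγ : 0 ≤ γ) (hγ1 : γ < 1) (hK : 0 ≤ K)
    (hc : 1 ≤ c) (hr : 0 < r) : P.ExponentiallyStable := by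
  have hM := one_le_gain hγ1 hK hc
  have hd : 0 < r / (c + 2 * K / (1 - γ)) := by positivity
  exact ⟨⟨H.lyapunovStable hγ hγ1 hK hc hr, _, hd, H.attractsWithin hγ hγ1 hK hc⟩,
    _, hd, _, _, isGainRate hγ hγ1 hK hc, H.expBoundWithin hγ hγ1 hK hc⟩

/-- The gain is independent of `r`, so the admissible size `r / gain` can be made arbitrarily large.
-/
theorem globallyExponentiallyStable (H : ∀ r, 0 < r → Contracts P R G c γ K r) (hγ : 0 ≤ γ)
    (hγ1 : γ < 1) (hK : 0 ≤ K) (hc : 1 ≤ c) : P.GloballyExponentiallyStable := by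
  have hM := one_le_gain hγ1 hK hc
  have hM0 : c + 2 * K / (1 - γ) ≠ 0 := by positivity
  refine ⟨⟨(H 1 one_pos).lyapunovStable hγ hγ1 hK hc one_pos, fun δ hδ => ?_⟩,
    _, _, isGainRate hγ hγ1 hK hc, fun δ hδ => ?_⟩
  · have := (H (δ * (c + 2 * K / (1 - γ))) (by positivity)).attractsWithin hγ hγ1 hK hc
    rwa [mul_div_cancel_right₀ _ hM0] at this
  · have := (H (δ * (c + 2 * K / (1 - γ))) (by positivity)).expBoundWithin hγ hγ1 hK hc
    rwa [mul_div_cancel_right₀ _ hM0] at this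

end Contracts

namespace RepProcess

variable {n m : ℕ} {P : RepProcess n m}

theorem LyapunovStable.zeroInitial (h : P.LyapunovStable) : P.zeroInitial.LyapunovStable := by
  intro ε hε
  obtain ⟨δ, h1, h2, h3⟩ := h ε hε
  exact ⟨δ, h1, h2, fun y₀ hy₀ ξ hξ => h3 y₀ hy₀ ξ hξ.1⟩

theorem AttractsWithin.zeroInitial {δ : ℝ} (h : P.AttractsWithin δ) :
    P.zeroInitial.AttractsWithin δ :=
  fun y₀ hy₀ ξ hξ => h y₀ hy₀ ξ hξ.1

theorem ExpBoundWithin.zeroInitial {K γ : ℝ → ℝ} {δ : ℝ} (h : P.ExpBoundWithin K γ δ) :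
    P.zeroInitial.ExpBoundWithin K γ δ :=
  fun lam hlam y₀ hy₀ ξ hξ => h lam hlam y₀ hy₀ ξ hξ.1

theorem ExponentiallyStable.zeroInitial (h : P.ExponentiallyStable) :
    P.zeroInitial.ExponentiallyStable := by
  obtain ⟨⟨h1, δ₂, h2, h3⟩, δ₃, h4, K, γ, h5, h6⟩ := h
  exact ⟨⟨h1.zeroInitial, δ₂, h2, h3.zeroInitial⟩, δ₃, h4, K, γ, h5, h6.zeroInitial⟩

theorem GloballyExponentiallyStable.zeroInitial (h : P.GloballyExponentiallyStable) :
    P.zeroInitial.GloballyExponentiallyStable := by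
  obtain ⟨⟨h1, h3⟩, K, γ, h5, h6⟩ := h
  exact ⟨⟨h1.zeroInitial, fun δ hδ => (h3 δ hδ).zeroInitial⟩, K, γ, h5,
    fun δ hδ => (h6 δ hδ).zeroInitial⟩

end RepProcess

end Comparison

/-! ### Linear approximation uniform in time -/

section LinearApproximation

open Filter Set

/-- `h` is approximated by its partial derivatives at the origin, uniformly in `t ∈ [0,T]`. -/
structure HasUniformLinearization {n m p : ℕ} (h : Vec n → Vec m → ℝ → Vec p) (T : ℝ) : Prop where
  continuousOn_partialState : ContinuousOn (partialState h) (Icc 0 T)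
  continuousOn_partialInput : ContinuousOn (partialInput h) (Icc 0 T)
  approx : ∀ η : ℝ, 0 < η → ∃ r : ℝ, 0 < r ∧ ∀ t ∈ Icc 0 T, ∀ x u, ‖x‖ ≤ r → ‖u‖ ≤ r →
    ‖h x u t - h 0 0 t - (partialState h t x + partialInput h t u)‖ ≤ η * (‖x‖ + ‖u‖)

/-- The derivative of the joint map within the product set, restricted to directions with zero time
component. As `X` and `V` are open, this is a genuine derivative in state and input even at the end
points of `[0,T]`. -/
theorem exists_continuousOn_hasFDerivAt {n m p : ℕ} {h : Vec n → Vec m → ℝ → Vec p} {T : ℝ}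
    (hT : 0 < T) {X : Set (Vec n)} (hX : IsOpen X) {V : Set (Vec m)} (hV : IsOpen V)
    (hh : ContDiffOn ℝ 1 (fun z : Vec n × Vec m × ℝ => h z.1 z.2.1 z.2.2)
      (X ×ˢ V ×ˢ Icc (0 : ℝ) T)) :
    ∃ Φ : Vec n × Vec m × ℝ → (Vec n × Vec m →L[ℝ] Vec p),
      ContinuousOn Φ (X ×ˢ V ×ˢ Icc (0 : ℝ) T) ∧
      ∀ x ∈ X, ∀ u ∈ V, ∀ t ∈ Icc (0 : ℝ) T,
        HasFDerivAt (fun q : Vec n × Vec m => h q.1 q.2 t) (Φ (x, u, t)) (x, u) := by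
  set S := X ×ˢ V ×ˢ Icc (0 : ℝ) T
  set F := fun z : Vec n × Vec m × ℝ => h z.1 z.2.1 z.2.2
  have hS : UniqueDiffOn ℝ S := hX.uniqueDiffOn.prod (hV.uniqueDiffOn.prod (uniqueDiffOn_Icc hT))
  let J : Vec n × Vec m →L[ℝ] Vec n × Vec m × ℝ :=
    (ContinuousLinearMap.fst ℝ _ _).prod ((ContinuousLinearMap.snd ℝ _ _).prod 0)
  refine ⟨fun z => (fderivWithin ℝ F S z).comp J,
    (hh.continuousOn_fderivWithin hS le_rfl).clm_comp continuousOn_const, ?_⟩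
  intro x hx u hu t ht
  have h1 : HasFDerivWithinAt F (fderivWithin ℝ F S (x, u, t)) S (x, u, t) :=
    ((hh.differentiableOn one_ne_zero) (x, u, t) ⟨hx, hu, ht⟩).hasFDerivWithinAt
  have h2 : HasFDerivWithinAt (fun q : Vec n × Vec m => (q.1, q.2, t)) J (X ×ˢ V) (x, u) :=
    (hasFDerivAt_fst.prodMk (hasFDerivAt_snd.prodMk
      (hasFDerivAt_const t (x, u)))).hasFDerivWithinAt
  have hmaps : MapsTo (fun q : Vec n × Vec m => (q.1, q.2, t)) (X ×ˢ V) S :=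
    fun q hq => ⟨hq.1, hq.2, ht⟩
  exact (HasFDerivWithinAt.comp (x, u) h1 h2 hmaps).hasFDerivAt ((hX.prod hV).mem_nhds ⟨hx, hu⟩)

/-- The mean value inequality on a small ball: uniform continuity of the derivative on a compact
neighbourhood keeps it within `η` of its value at the origin, for all `t` at once. -/
theorem hasUniformLinearization_of_pos {n m p : ℕ} {h : Vec n → Vec m → ℝ → Vec p} {T : ℝ}
    (hT : 0 < T) {X : Set (Vec n)} (hX : IsOpen X) (hX0 : 0 ∈ X) {V : Set (Vec m)} (hV : IsOpen V)
    (hV0 : 0 ∈ V) (hh : ContDiffOn ℝ 1 (fun z : Vec n × Vec m × ℝ => h z.1 z.2.1 z.2.2)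
      (X ×ˢ V ×ˢ Icc (0 : ℝ) T)) : HasUniformLinearization h T := by
  obtain ⟨Φ, hΦ, hd⟩ := exists_continuousOn_hasFDerivAt hT hX hV hh
  have hs : ∀ t ∈ Icc (0 : ℝ) T,
      partialState h t = (Φ (0, 0, t)).comp (ContinuousLinearMap.inl ℝ _ _) := by
    intro t ht
    have h1 : HasFDerivAt (fun x : Vec n => (x, (0 : Vec m))) (ContinuousLinearMap.inl ℝ _ _) 0 :=
      hasFDerivAt_prodMk_left 0 0
    exact (HasFDerivAt.comp (g := fun q : Vec n × Vec m => h q.1 q.2 t)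
      (f := fun x : Vec n => (x, (0 : Vec m))) 0 (hd 0 hX0 0 hV0 t ht) h1).fderiv
  have hi : ∀ t ∈ Icc (0 : ℝ) T,
      partialInput h t = (Φ (0, 0, t)).comp (ContinuousLinearMap.inr ℝ _ _) := by
    intro t ht
    have h1 : HasFDerivAt (fun u : Vec m => ((0 : Vec n), u)) (ContinuousLinearMap.inr ℝ _ _) 0 :=
      hasFDerivAt_prodMk_right 0 0
    exact (HasFDerivAt.comp (g := fun q : Vec n × Vec m => h q.1 q.2 t)
      (f := fun u : Vec m => ((0 : Vec n), u)) 0 (hd 0 hX0 0 hV0 t ht) h1).fderiv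
  have hc : ContinuousOn (fun t => Φ (0, 0, t)) (Icc 0 T) :=
    hΦ.comp (f := fun t : ℝ => ((0 : Vec n), (0 : Vec m), t)) (by fun_prop)
      (fun t ht => ⟨hX0, hV0, ht⟩)
  refine ⟨(hc.clm_comp continuousOn_const).congr hs, (hc.clm_comp continuousOn_const).congr hi,
    fun η hη => ?_⟩
  obtain ⟨r₁, hr₁, hr₁X⟩ := Metric.nhds_basis_closedBall.mem_iff.1 (hX.mem_nhds hX0)
  obtain ⟨r₂, hr₂, hr₂V⟩ := Metric.nhds_basis_closedBall.mem_iff.1 (hV.mem_nhds hV0)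
  have hK : IsCompact (Metric.closedBall (0 : Vec n) r₁ ×ˢ Metric.closedBall (0 : Vec m) r₂ ×ˢ
      Icc (0 : ℝ) T) :=
    (isCompact_closedBall _ _).prod ((isCompact_closedBall _ _).prod isCompact_Icc)
  have hKS : Metric.closedBall (0 : Vec n) r₁ ×ˢ Metric.closedBall (0 : Vec m) r₂ ×ˢ
      Icc (0 : ℝ) T ⊆ X ×ˢ V ×ˢ Icc (0 : ℝ) T := prod_mono hr₁X (prod_mono hr₂V le_rfl)
  obtain ⟨r₃, hr₃, hu⟩ := Metric.uniformContinuousOn_iff.1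
    (hK.uniformContinuousOn_of_continuous (hΦ.mono hKS)) η hη
  set r := min (min r₁ r₂) (r₃ / 2)
  have hr1 : r ≤ r₁ := (min_le_left _ _).trans (min_le_left _ _)
  have hr2 : r ≤ r₂ := (min_le_left _ _).trans (min_le_right _ _)
  have hr3 : r < r₃ := (min_le_right _ _).trans_lt (by linarith)
  have hr : 0 < r := by positivity
  refine ⟨r, hr, fun t ht x u hx hu' => ?_⟩
  have hbd : ∀ x' ∈ Metric.closedBall (0 : Vec n) r, ∀ u' ∈ Metric.closedBall (0 : Vec m) r,
      ‖Φ (x', u', t) - Φ (0, 0, t)‖ ≤ η := by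
    intro x' hx' u' hu'
    rw [← dist_eq_norm]
    refine (hu (x', u', t) ⟨Metric.closedBall_subset_closedBall hr1 hx',
      Metric.closedBall_subset_closedBall hr2 hu', ht⟩ (0, 0, t)
      ⟨Metric.mem_closedBall_self hr₁.le, Metric.mem_closedBall_self hr₂.le, ht⟩ ?_).le
    rw [Prod.dist_eq, Prod.dist_eq, dist_self]
    exact max_lt (lt_of_le_of_lt hx' hr3) (max_lt (lt_of_le_of_lt hu' hr3) hr₃)
  have hmv := (((convex_closedBall (0 : Vec n) r).prod
    (convex_closedBall (0 : Vec m) r))).norm_image_sub_le_of_norm_hasFDerivWithin_le'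
    (f := fun q : Vec n × Vec m => h q.1 q.2 t) (f' := fun q => Φ (q.1, q.2, t))
    (φ := Φ (0, 0, t)) (C := η) (x := (0, 0)) (y := (x, u))
    (fun q hq => (hd q.1 (hr₁X (Metric.closedBall_subset_closedBall hr1 hq.1)) q.2
      (hr₂V (Metric.closedBall_subset_closedBall hr2 hq.2)) t ht).hasFDerivWithinAt)
    (fun q hq => hbd q.1 hq.1 q.2 hq.2)
    ⟨Metric.mem_closedBall_self hr.le, Metric.mem_closedBall_self hr.le⟩
    ⟨mem_closedBall_zero_iff.2 hx, mem_closedBall_zero_iff.2 hu'⟩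
  have hsplit : Φ (0, 0, t) ((x, u) - (0, 0)) = partialState h t x + partialInput h t u := by
    rw [hs t ht, hi t ht, ContinuousLinearMap.comp_apply, ContinuousLinearMap.comp_apply, ← map_add]
    simp
  rw [hsplit] at hmv
  refine hmv.trans (mul_le_mul_of_nonneg_left ?_ hη.le)
  rw [show (x, u) - ((0 : Vec n), (0 : Vec m)) = (x, u) by simp]
  exact max_le_add_of_nonneg (norm_nonneg _) (norm_nonneg _)

theorem hasUniformLinearization {n m p : ℕ} {h : Vec n → Vec m → ℝ → Vec p} {T : ℝ}
    (hT : 0 ≤ T) {X : Set (Vec n)} (hX : IsOpen X) (hX0 : 0 ∈ X) {V : Set (Vec m)} (hV : IsOpen V)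
    (hV0 : 0 ∈ V) (hh : ContDiffOn ℝ 1 (fun z : Vec n × Vec m × ℝ => h z.1 z.2.1 z.2.2)
      (X ×ˢ V ×ˢ Icc (0 : ℝ) T)) : HasUniformLinearization h T := by
  rcases hT.eq_or_lt with rfl | hT
  · have h0 : (0 : ℝ) ∈ Icc (0 : ℝ) 0 := by simp
    -- For `T = 0` the time interval is a point and lacks unique differentiability; the map is made
    -- constant in time on `[0,1]` instead.
    have h1 : HasUniformLinearization (fun x u _ => h x u 0) 1 := by
      refine hasUniformLinearization_of_pos one_pos hX hX0 hV hV0 ?_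
      exact hh.comp (f := fun z : Vec n × Vec m × ℝ => (z.1, z.2.1, (0 : ℝ)))
        (by fun_prop) (fun z hz => ⟨hz.1, hz.2.1, h0⟩)
    refine ⟨?_, ?_, fun η hη => ?_⟩
    · rw [Icc_self]; exact continuousOn_singleton _ _
    · rw [Icc_self]; exact continuousOn_singleton _ _
    · obtain ⟨r, hr, h2⟩ := h1.approx η hη
      refine ⟨r, hr, fun t ht => ?_⟩
      obtain rfl : t = 0 := by simpa using ht
      exact h2 0 (by simp)
  · exact hasUniformLinearization_of_pos hT hX hX0 hV hV0 hh

theorem exists_norm_le_of_continuousOn {E : Type*} [SeminormedAddCommGroup E] {A : ℝ → E} {T : ℝ}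
    (hA : ContinuousOn A (Icc 0 T)) : ∃ C : ℝ, 0 < C ∧ ∀ t ∈ Icc 0 T, ‖A t‖ ≤ C := by
  obtain ⟨C, hC⟩ := isCompact_Icc.exists_bound_of_continuousOn hA
  exact ⟨max C 1, by positivity, fun t ht => (hC t ht).trans (le_max_left _ _)⟩

end LinearApproximation

/-! ### Estimates for one pass in exponentially weighted adapted norms -/

section PassEstimates

open Filter Set Real

theorem exists_continuous_eqOn_Icc {E : Type*} [TopologicalSpace E] {χ : ℝ → E} {T : ℝ}
    (hT : 0 ≤ T) (hχ : ContinuousOn χ (Icc 0 T)) :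
    ∃ χ' : ℝ → E, Continuous χ' ∧ EqOn χ' χ (Icc 0 T) :=
  ⟨IccExtend hT ((Icc 0 T).domRestrict χ), hχ.domRestrict.Icc_extend',
    fun x hx => by rw [IccExtend_of_mem hT _ hx, domRestrict_apply]⟩

/-- Exponential barrier for a function whose derivative is bounded linearly on a ball. -/
theorem norm_le_exp_of_deriv_bound {E : Type*} [NormedAddCommGroup E] [NormedSpace ℝ E]
    {φ φ' : ℝ → E} {T a b r L κ s ξ₀ : ℝ} (hb : 0 ≤ b) (hs : 0 ≤ s)
    (haL : a < L) (hbL : b ≤ (L - a) * κ) (hL : 0 ≤ L) (hφ : ContinuousOn φ (Icc 0 T))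
    (hφ' : ∀ t ∈ Ico 0 T, HasDerivWithinAt φ (φ' t) (Ici t) t) (h0 : ‖φ 0‖ ≤ ξ₀)
    (hbound : ∀ t ∈ Ico 0 T, ‖φ t‖ ≤ r → ‖φ' t‖ ≤ a * ‖φ t‖ + b * (s * exp (L * t)))
    (hr : (ξ₀ + κ * s) * exp (L * T) < r) :
    ∀ t ∈ Icc 0 T, ‖φ t‖ ≤ (ξ₀ + κ * s) * exp (L * t) := by
  intro t ht
  have hξ : 0 ≤ ξ₀ := (norm_nonneg _).trans h0
  have hκ : 0 ≤ κ := by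
    by_contra! h
    nlinarith [mul_pos (sub_pos.2 haL) (neg_pos.2 h)]
  have hlim : Tendsto (fun ε : ℝ => (ξ₀ + κ * s + ε) * exp (L * t)) (𝓝[>] 0)
      (𝓝 ((ξ₀ + κ * s + 0) * exp (L * t))) :=
    ((by fun_prop : Continuous fun ε : ℝ => (ξ₀ + κ * s + ε) * exp (L * t)).tendsto 0).mono_left
      nhdsWithin_le_nhds
  -- The extra `ε` makes the barrier strictly steeper than the function at a contact point, while
  -- the barrier still stays below `r`, where the derivative bound is available.
  have hsmall : ∀ᶠ ε : ℝ in 𝓝[>] 0, (ξ₀ + κ * s + ε) * exp (L * T) < r := by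
    refine Tendsto.eventually_lt_const (u := r) ?_
      (((by fun_prop : Continuous fun ε : ℝ => (ξ₀ + κ * s + ε) * exp (L * T)).tendsto 0).mono_left
        nhdsWithin_le_nhds)
    simpa using hr
  rw [add_zero] at hlim
  refine ge_of_tendsto hlim ?_
  filter_upwards [hsmall, self_mem_nhdsWithin] with ε hε hε0
  have hε0 : 0 < ε := hε0
  have hB : ∀ x, HasDerivAt (fun t => (ξ₀ + κ * s + ε) * exp (L * t))
      ((ξ₀ + κ * s + ε) * (exp (L * x) * L)) x := fun x =>
    (((hasDerivAt_id x).const_mul L).exp.const_mul _).congr_deriv (by simp)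
  refine image_norm_le_of_norm_deriv_right_lt_deriv_boundary' hφ hφ'
    (B := fun t => (ξ₀ + κ * s + ε) * exp (L * t)) ?_ (by fun_prop)
    (fun x _ => (hB x).hasDerivWithinAt) ?_ ht
  · simp only [mul_zero, exp_zero, mul_one]
    nlinarith [mul_nonneg hκ hs]
  · intro x hx hxB
    have hp := exp_pos (L * x)
    have hle : exp (L * x) ≤ exp (L * T) := exp_le_exp.2 (mul_le_mul_of_nonneg_left hx.2.le hL)
    refine (hbound x hx ?_).trans_lt ?_
    · rw [hxB]
      exact (mul_le_mul_of_nonneg_left hle (by positivity)).trans hε.le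
    · rw [hxB]
      have h1 : a * (ξ₀ + κ * s + ε) + b * s < (ξ₀ + κ * s + ε) * L := by
        have h2 : b * s ≤ (L - a) * κ * s := mul_le_mul_of_nonneg_right hbL hs
        have h3 : 0 < (L - a) * ε := mul_pos (sub_pos.2 haL) hε0
        have h4 : 0 ≤ (L - a) * ξ₀ := mul_nonneg (sub_pos.2 haL).le hξ
        nlinarith
      have h5 := mul_lt_mul_of_pos_right h1 hp
      nlinarith

theorem IsCurve.continuousOn {n m : ℕ} {f : Vec n → Vec m → ℝ → Vec n} {T : ℝ} {u : ℝ → Vec m}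
    {χ : ℝ → Vec n} (h : IsCurve f T u χ) : ContinuousOn χ (Icc 0 T) :=
  fun t ht => (h t ht).continuousWithinAt

/-- The barrier keeps the curve inside the ball of radius `r`, so a bound on `f` near the origin is
enough. The input contributes only the factor `κ`, which is small when `L` is large. -/
theorem IsCurve.norm_le {n m : ℕ} {f : Vec n → Vec m → ℝ → Vec n} {T a b r L κ s : ℝ}
    {u : ℝ → Vec m} {χ : ℝ → Vec n} (hχ : IsCurve f T u χ) (hb : 0 ≤ b) (hs : 0 ≤ s)
    (haL : a < L) (hbL : b ≤ (L - a) * κ) (hL : 0 ≤ L)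
    (hf : ∀ t ∈ Icc 0 T, ∀ x v, ‖x‖ ≤ r → ‖v‖ ≤ r → ‖f x v t‖ ≤ a * ‖x‖ + b * ‖v‖)
    (hu : ∀ t ∈ Icc 0 T, ‖u t‖ ≤ s * exp (L * t)) (hsr : s * exp (L * T) ≤ r)
    (hr : (‖χ 0‖ + κ * s) * exp (L * T) < r) :
    ∀ t ∈ Icc 0 T, ‖χ t‖ ≤ (‖χ 0‖ + κ * s) * exp (L * t) := by
  refine norm_le_exp_of_deriv_bound hb hs haL hbL hL hχ.continuousOn
    (fun t ht => (hχ t (Ico_subset_Icc_self ht)).mono_of_mem_nhdsWithin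
      (Icc_mem_nhdsGE_of_mem ht)) le_rfl (fun t ht hφ => ?_) hr
  have ht' := Ico_subset_Icc_self ht
  have h1 : ‖u t‖ ≤ r := (hu t ht').trans ((mul_le_mul_of_nonneg_left
    (exp_le_exp.2 (mul_le_mul_of_nonneg_left ht.2.le hL)) hs).trans hsr)
  exact (hf t ht' _ _ hφ h1).trans (by gcongr; exact hu t ht')

/-- The barrier is applied to the right-hand side, a differentiable majorant of `‖χ‖`; no derivative
of `χ` is needed, which suits integrated equations with `L^∞` inputs. -/
theorem norm_le_exp_of_le_integral {E : Type*} [NormedAddCommGroup E] {χ : ℝ → E}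
    {T a b L κ s ξ₀ : ℝ} (ha : 0 ≤ a) (hb : 0 ≤ b) (hs : 0 ≤ s) (hT : 0 ≤ T)
    (haL : a < L) (hbL : b ≤ (L - a) * κ) (hL : 0 ≤ L) (hξ : 0 ≤ ξ₀) (hχ : ContinuousOn χ (Icc 0 T))
    (h : ∀ t ∈ Icc 0 T, ‖χ t‖ ≤ ξ₀ + ∫ x in (0 : ℝ)..t, (a * ‖χ x‖ + b * (s * exp (L * x)))) :
    ∀ t ∈ Icc 0 T, ‖χ t‖ ≤ (ξ₀ + κ * s) * exp (L * t) := by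
  obtain ⟨χ', hχ'c, hχ'⟩ := exists_continuous_eqOn_Icc hT hχ
  set ψ : ℝ → ℝ := fun x => a * ‖χ' x‖ + b * (s * exp (L * x))
  have hψ : Continuous ψ := by fun_prop
  have hψ0 : ∀ x, 0 ≤ ψ x := fun x => by positivity
  have hψχ : ∀ x ∈ Icc 0 T, ψ x = a * ‖χ x‖ + b * (s * exp (L * x)) := fun x hx => by
    simp only [ψ, hχ' hx]
  set φ : ℝ → ℝ := fun t => ξ₀ + ∫ x in (0 : ℝ)..t, ψ x
  have hφ' : ∀ t, HasDerivAt φ (ψ t) t := fun t =>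
    (intervalIntegral.integral_hasDerivAt_right (hψ.intervalIntegrable _ _)
      hψ.aestronglyMeasurable.stronglyMeasurableAtFilter hψ.continuousAt).const_add _
  have hφ0 : ∀ t ∈ Icc 0 T, 0 ≤ φ t := fun t ht =>
    add_nonneg hξ (intervalIntegral.integral_nonneg ht.1 fun x _ => hψ0 x)
  have hχφ : ∀ t ∈ Icc 0 T, ‖χ t‖ ≤ φ t := fun t ht => by
    refine (h t ht).trans_eq ?_
    simp only [φ]
    congr 1
    refine intervalIntegral.integral_congr fun x hx => ?_
    rw [uIcc_of_le ht.1] at hx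
    exact (hψχ x ⟨hx.1, hx.2.trans ht.2⟩).symm
  intro t ht
  refine (hχφ t ht).trans ((le_abs_self _).trans ?_)
  -- The derivative bound is global here, so any radius above the final barrier value will do.
  refine norm_le_exp_of_deriv_bound hb hs haL hbL hL
    (fun t _ => (hφ' t).continuousAt.continuousWithinAt) (fun t _ => (hφ' t).hasDerivWithinAt)
    (by simp [φ, abs_of_nonneg hξ]) (fun t ht _ => ?_) (lt_add_one _) t ht
  have ht' := Ico_subset_Icc_self ht
  rw [norm_of_nonneg (hψ0 t), norm_of_nonneg (hφ0 t ht'), hψχ t ht']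
  gcongr
  exact hχφ t ht'

/-- `v` has size at most `s e^{Lt}` in the norm `sup_j γ^{-j} ‖D(t)^j v‖` adapted to `D(t)`. -/
def PowBound {m : ℕ} (D : ℝ → Vec m →L[ℝ] Vec m) (γ L s t : ℝ) (v : Vec m) : Prop :=
  ∀ j : ℕ, ‖(D t ^ j) v‖ ≤ s * γ ^ j * exp (L * t)

namespace PowBound

variable {m : ℕ} {D : ℝ → Vec m →L[ℝ] Vec m} {γ L s t : ℝ} {v : Vec m}

theorem norm_le (h : PowBound D γ L s t v) : ‖v‖ ≤ s * exp (L * t) := by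
  simpa using h 0

theorem mono (h : PowBound D γ L s t v) (hγ : 0 ≤ γ) {s' : ℝ} (hs : s ≤ s') :
    PowBound D γ L s' t v :=
  fun j => (h j).trans (by gcongr)

theorem of_norm_le {c σ : ℝ} (hD : ∀ k, ‖D t ^ k‖ ≤ c * γ ^ k) (hγ : 0 ≤ γ) (hc : 0 ≤ c)
    (hσ : 0 ≤ σ) (hL : 0 ≤ L) (ht : 0 ≤ t) (hv : ‖v‖ ≤ σ) : PowBound D γ L (c * σ) t v := by
  intro j
  calc ‖(D t ^ j) v‖ ≤ ‖D t ^ j‖ * ‖v‖ := (D t ^ j).le_opNorm v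
    _ ≤ c * γ ^ j * σ := by gcongr; exact hD j
    _ = c * σ * γ ^ j * 1 := by ring
    _ ≤ c * σ * γ ^ j * exp (L * t) := by gcongr; exact one_le_exp (by positivity)

/-- Applying `D(t)` shifts `j` to `j + 1` in the adapted norm and so gains a factor `γ`; the
perturbation `w` pays the comparison constant `c`. -/
theorem apply_add {c ω : ℝ} {w : Vec m} (h : PowBound D γ L s t v)
    (hD : ∀ k, ‖D t ^ k‖ ≤ c * γ ^ k) (hγ : 0 ≤ γ) (hc : 0 ≤ c) (hw : ‖w‖ ≤ ω * exp (L * t)) :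
    PowBound D γ L (γ * s + c * ω) t (D t v + w) := by
  intro j
  calc ‖(D t ^ j) (D t v + w)‖ = ‖(D t ^ (j + 1)) v + (D t ^ j) w‖ := by
        rw [map_add, pow_succ, mul_apply_eq_comp]
    _ ≤ s * γ ^ (j + 1) * exp (L * t) + c * γ ^ j * (ω * exp (L * t)) := by
        refine (norm_add_le _ _).trans (add_le_add (h _) (((D t ^ j).le_opNorm w).trans ?_))
        gcongr
        exact hD j
    _ = (γ * s + c * ω) * γ ^ j * exp (L * t) := by ring

end PowBound

/-- Constants for which one pass contracts the norms adapted to `D(t)`, weighted by `e^{-Lt}`. -/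
structure PassConstants {m : ℕ} (D : ℝ → Vec m →L[ℝ] Vec m) (T a b c c₁ γ η κ L : ℝ) : Prop where
  a_nonneg : 0 ≤ a
  b_nonneg : 0 ≤ b
  one_le_c : 1 ≤ c
  c₁_pos : 0 < c₁
  γ_pos : 0 < γ
  γ_lt_one : γ < 1
  κ_nonneg : 0 ≤ κ
  L_nonneg : 0 ≤ L
  a_lt_L : a < L
  b_le : b ≤ (L - a) * κ
  gain_le : γ + c * (c₁ * κ + η) ≤ (1 + γ) / 2
  norm_pow_le : ∀ t ∈ Icc 0 T, ∀ k, ‖D t ^ k‖ ≤ c * γ ^ k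

/-- The two perturbations `c * c₁ * κ` and `c * η` each use up `(1-γ)/4` of the gap. With `κ` fixed,
`L` is then taken large; the summand `1` ensures `a < L`. -/
theorem exists_passConstants {m : ℕ} {D : ℝ → Vec m →L[ℝ] Vec m} {T c γ : ℝ} (hc : 1 ≤ c)
    (hγ : 0 < γ) (hγ1 : γ < 1) (hD : ∀ t ∈ Icc 0 T, ∀ k, ‖D t ^ k‖ ≤ c * γ ^ k) {a b c₁ : ℝ}
    (ha : 0 ≤ a) (hb : 0 ≤ b) (hc₁ : 0 < c₁) :
    ∃ κ L, PassConstants D T a b c c₁ γ ((1 - γ) / (4 * c)) κ L := by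
  have h1 : 0 < 1 - γ := by linarith
  set κ := (1 - γ) / (4 * c * c₁) with hκ
  have hκ0 : 0 < κ := by positivity
  refine ⟨κ, a + b / κ + 1, ha, hb, hc, hc₁, hγ, hγ1, hκ0.le, by positivity, ?_, ?_, ?_, hD⟩
  · have : 0 ≤ b / κ := by positivity
    linarith
  · have : b / κ * κ = b := div_mul_cancel₀ _ hκ0.ne'
    nlinarith
  · have : c * (c₁ * κ + (1 - γ) / (4 * c)) = (1 - γ) / 2 := by
      rw [hκ]; field_simp; ring
    linarith

namespace PassConstants

variable {m : ℕ} {D : ℝ → Vec m →L[ℝ] Vec m} {T a b c c₁ γ η κ L : ℝ}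

/-- `w` is split into `D(t) u`, contracted by `γ`, and an error controlled by the state and by `η
‖u‖`. -/
theorem output (H : PassConstants D T a b c c₁ γ η κ L) {n : ℕ} {t s ξ₀ : ℝ} (ht : t ∈ Icc 0 T)
    (hs : 0 ≤ s) (hη : 0 ≤ η) {x : Vec n} {u w : Vec m} (hu : PowBound D γ L s t u)
    (hx : ‖x‖ ≤ (ξ₀ + κ * s) * exp (L * t)) (hw : ‖w - D t u‖ ≤ c₁ * ‖x‖ + η * ‖u‖) :
    PowBound D γ L ((1 + γ) / 2 * s + c * c₁ * ξ₀) t w := by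
  have hc₁ := H.c₁_pos
  have h1 : ‖w - D t u‖ ≤ (c₁ * (ξ₀ + κ * s) + η * s) * exp (L * t) := by
    refine hw.trans ?_
    calc c₁ * ‖x‖ + η * ‖u‖ ≤ c₁ * ((ξ₀ + κ * s) * exp (L * t)) + η * (s * exp (L * t)) := by
          gcongr; exact hu.norm_le
      _ = _ := by ring
  have h2 := hu.apply_add (H.norm_pow_le t ht) H.γ_pos.le (zero_le_one.trans H.one_le_c) h1
  rw [add_sub_cancel] at h2
  refine h2.mono H.γ_pos.le ?_
  have := mul_le_mul_of_nonneg_right H.gain_le hs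
  linarith

theorem curve (H : PassConstants D T a b c c₁ γ η κ L) {n : ℕ} {f : Vec n → Vec m → ℝ → Vec n}
    {g : Vec n → Vec m → ℝ → Vec m} {r s : ℝ} (hs : 0 ≤ s) (hη : 0 ≤ η)
    (hf : ∀ t ∈ Icc 0 T, ∀ x v, ‖x‖ ≤ r → ‖v‖ ≤ r → ‖f x v t‖ ≤ a * ‖x‖ + b * ‖v‖)
    (hg : ∀ t ∈ Icc 0 T, ∀ x v, ‖x‖ ≤ r → ‖v‖ ≤ r → ‖g x v t - D t v‖ ≤ c₁ * ‖x‖ + η * ‖v‖)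
    {u : ℝ → Vec m} {χ : ℝ → Vec n} (hχ : IsCurve f T u χ)
    (hu : ∀ t ∈ Icc 0 T, PowBound D γ L s t (u t)) (hsr : s * exp (L * T) ≤ r)
    (hr : (‖χ 0‖ + κ * s) * exp (L * T) < r) :
    ∀ t ∈ Icc 0 T, PowBound D γ L ((1 + γ) / 2 * s + c * c₁ * ‖χ 0‖) t (g (χ t) (u t) t) := by
  intro t ht
  have h1 := hχ.norm_le H.b_nonneg hs H.a_lt_L H.b_le H.L_nonneg hf
    (fun t ht => (hu t ht).norm_le) hsr hr t ht
  have hle : exp (L * t) ≤ exp (L * T) := exp_le_exp.2 (mul_le_mul_of_nonneg_left ht.2 H.L_nonneg)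
  have hκ := H.κ_nonneg
  refine H.output ht hs hη (hu t ht) h1 (hg t ht _ _ (h1.trans ?_) ((hu t ht).norm_le.trans ?_))
  · exact (mul_le_mul_of_nonneg_left hle (by positivity)).trans hr.le
  · exact (mul_le_mul_of_nonneg_left hle hs).trans hsr

end PassConstants

end PassEstimates

/-! ### The spectral condition implies exponential stability of the nonlinear process -/

section Nonlinear

open Filter Set Real

theorem supNorm_le_ofReal_iff {p : ℕ} {T σ : ℝ} (hσ : 0 ≤ σ) {u : ℝ → Vec p} :
    supNorm T u ≤ ENNReal.ofReal σ ↔ ∀ t ∈ Icc 0 T, ‖u t‖ ≤ σ := by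
  simp only [supNorm, iSup_le_iff, ← ofReal_norm, ENNReal.ofReal_le_ofReal_iff hσ]

theorem IsCurve.contDiffOn {n m : ℕ} {f : Vec n → Vec m → ℝ → Vec n} {T : ℝ} (hT : 0 ≤ T)
    {u : ℝ → Vec m} {χ : ℝ → Vec n} (h : IsCurve f T u χ)
    (hc : ContinuousOn (fun t => f (χ t) (u t) t) (Icc 0 T)) : ContDiffOn ℝ 1 χ (Icc 0 T) := by
  rcases hT.eq_or_lt with rfl | hT
  · refine (contDiffOn_const (c := χ 0)).congr fun t ht => ?_
    rw [show t = 0 by simpa using ht]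
  · rw [contDiffOn_one_iff_derivWithin (uniqueDiffOn_Icc hT)]
    exact ⟨fun t ht => (h t ht).differentiableWithinAt,
      hc.congr fun t ht => (h t ht).derivWithin (uniqueDiffOn_Icc hT t ht)⟩

theorem HasUniformLinearization.exists_norm_le {n m p : ℕ} {h : Vec n → Vec m → ℝ → Vec p} {T : ℝ}
    (H : HasUniformLinearization h T) (h0 : ∀ t ∈ Icc (0 : ℝ) T, h 0 0 t = 0) :
    ∃ a b r : ℝ, 0 ≤ a ∧ 0 ≤ b ∧ 0 < r ∧
      ∀ t ∈ Icc 0 T, ∀ x u, ‖x‖ ≤ r → ‖u‖ ≤ r → ‖h x u t‖ ≤ a * ‖x‖ + b * ‖u‖ := by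
  obtain ⟨a, ha, hA⟩ := exists_norm_le_of_continuousOn H.continuousOn_partialState
  obtain ⟨b, hb, hB⟩ := exists_norm_le_of_continuousOn H.continuousOn_partialInput
  obtain ⟨r, hr, happ⟩ := H.approx 1 one_pos
  refine ⟨a + 1, b + 1, r, by positivity, by positivity, hr, fun t ht x u hx hu => ?_⟩
  have h1 := happ t ht x u hx hu
  rw [h0 t ht, sub_zero] at h1
  have h2 := (partialState h t).le_of_opNorm_le (hA t ht) x
  have h3 := (partialInput h t).le_of_opNorm_le (hB t ht) u
  have h4 := norm_le_norm_add_norm_sub' (h x u t) (partialState h t x + partialInput h t u)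
  have h5 := norm_add_le (partialState h t x) (partialInput h t u)
  linarith

/-- The state derivative is absorbed into `c₁`, which is fixed before `η`; only the radius depends
on `η`. This allows `η` to be chosen small afterwards. -/
theorem HasUniformLinearization.exists_norm_sub_le {n m p : ℕ} {h : Vec n → Vec m → ℝ → Vec p}
    {T : ℝ} (H : HasUniformLinearization h T) (h0 : ∀ t ∈ Icc (0 : ℝ) T, h 0 0 t = 0) :
    ∃ c₁ : ℝ, 0 < c₁ ∧ ∀ η : ℝ, 0 < η → η ≤ 1 → ∃ r : ℝ, 0 < r ∧
      ∀ t ∈ Icc 0 T, ∀ x u, ‖x‖ ≤ r → ‖u‖ ≤ r →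
        ‖h x u t - partialInput h t u‖ ≤ c₁ * ‖x‖ + η * ‖u‖ := by
  obtain ⟨a, ha, hA⟩ := exists_norm_le_of_continuousOn H.continuousOn_partialState
  refine ⟨a + 1, by positivity, fun η hη hη1 => ?_⟩
  obtain ⟨r, hr, happ⟩ := H.approx η hη
  refine ⟨r, hr, fun t ht x u hx hu => ?_⟩
  have h1 := happ t ht x u hx hu
  rw [h0 t ht, sub_zero] at h1
  have h2 := (partialState h t).le_of_opNorm_le (hA t ht) x
  have h3 := norm_add_le (h x u t - (partialState h t x + partialInput h t u)) (partialState h t x)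
  rw [show h x u t - (partialState h t x + partialInput h t u) + partialState h t x =
    h x u t - partialInput h t u by abel] at h3
  nlinarith [norm_nonneg x]

theorem MaxRhoLtOne.forall_lt {m : ℕ} {D : ℝ → Vec m →L[ℝ] Vec m} {T : ℝ} (h : MaxRhoLtOne D T) :
    ∀ t ∈ Icc 0 T, rho (D t) < 1 := by
  obtain ⟨r, hr, hr1⟩ := h
  exact fun t ht => (hr.2 (mem_image_of_mem _ ht)).trans_lt hr1

theorem maxRhoLtOne_of_forall_lt {m : ℕ} {D : ℝ → Vec m →L[ℝ] Vec m} {T : ℝ} (hT : 0 ≤ T)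
    (hD : ContinuousOn D (Icc 0 T)) (h : ∀ t ∈ Icc 0 T, rho (D t) < 1) : MaxRhoLtOne D T := by
  obtain ⟨t, ht, hmax⟩ := exists_isGreatest_rho isCompact_Icc (nonempty_Icc.2 hT) hD
  exact ⟨_, hmax, h t ht⟩

variable {n m : ℕ} {T : ℝ} {f : Vec n → Vec m → ℝ → Vec n} {g : Vec n → Vec m → ℝ → Vec m}
  {X : Set (Vec n)} {Y : Set (Vec m)} {δ : ℝ}

/-- The initial value problem is well posed in `X` for small data. -/
def WellPosed (f : Vec n → Vec m → ℝ → Vec n) (T : ℝ) (X : Set (Vec n)) (δ : ℝ) : Prop :=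
  ∀ (ξ : Vec n) (u : ℝ → Vec m), ContDiffOn ℝ 1 u (Icc 0 T) →
    ‖ξ‖ₑ + supNorm T u < ENNReal.ofReal δ →
      ∃ χ : ℝ → Vec n, χ 0 = ξ ∧ IsCurve f T u χ ∧ MapsTo χ (Icc 0 T) X ∧
        ∀ χ' : ℝ → Vec n, χ' 0 = ξ → IsCurve f T u χ' → EqOn χ' χ (Icc 0 T)

/-- The solution with zero data starts at `0` and lies in `X`. -/
theorem WellPosed.zero_mem (h : WellPosed f T X δ) (hT : 0 ≤ T) (hδ : 0 < δ) : 0 ∈ X := by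
  obtain ⟨χ, hχ0, -, hχX, -⟩ := h 0 (fun _ => 0) contDiffOn_const (by simpa [supNorm] using hδ)
  exact hχ0 ▸ hχX (left_mem_Icc.2 hT)

theorem contDiffOn_output {χ : ℝ → Vec n} {u : ℝ → Vec m}
    (hg : ContDiffOn ℝ 1 (fun z : Vec n × Vec m × ℝ => g z.1 z.2.1 z.2.2)
      (closure X ×ˢ Y ×ˢ Icc (0 : ℝ) T))
    (hχ : ContDiffOn ℝ 1 χ (Icc 0 T)) (hu : ContDiffOn ℝ 1 u (Icc 0 T))
    (hχX : MapsTo χ (Icc 0 T) X) (huY : MapsTo u (Icc 0 T) Y) :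
    ContDiffOn ℝ 1 (fun t => g (χ t) (u t) t) (Icc 0 T) :=
  hg.comp (f := fun t => (χ t, u t, t)) (hχ.prodMk (hu.prodMk contDiffOn_id))
    (fun _ ht => ⟨subset_closure (hχX ht), huY ht, ht⟩)

theorem continuousOn_vectorField {χ : ℝ → Vec n} {u : ℝ → Vec m}
    (hf : ContDiffOn ℝ 1 (fun z : Vec n × Vec m × ℝ => f z.1 z.2.1 z.2.2)
      (closure X ×ˢ Y ×ˢ Icc (0 : ℝ) T))
    (hχ : ContinuousOn χ (Icc 0 T)) (hu : ContinuousOn u (Icc 0 T))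
    (hχX : MapsTo χ (Icc 0 T) X) (huY : MapsTo u (Icc 0 T) Y) :
    ContinuousOn (fun t => f (χ t) (u t) t) (Icc 0 T) :=
  hf.continuousOn.comp (f := fun t => (χ t, u t, t)) (hχ.prodMk (hu.prodMk continuousOn_id))
    (fun _ ht => ⟨subset_closure (hχX ht), huY ht, ht⟩)

/-- `v` has size at most `s e^{L(t-T)}` in the norm adapted to `D(t)`. -/
def Gauge (D : ℝ → Vec m →L[ℝ] Vec m) (T γ L s t : ℝ) (v : Vec m) : Prop :=
  PowBound D γ L (s * exp (-(L * T))) t v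

/-- The normalization `e^{-LT}` makes the weight at most `1` on `[0,T]`, so the gauge dominates the
uniform norm. -/
theorem Gauge.norm_le {D : ℝ → Vec m →L[ℝ] Vec m} {γ L s t : ℝ} {v : Vec m}
    (h : Gauge D T γ L s t v) (hL : 0 ≤ L) (hs : 0 ≤ s) (ht : t ≤ T) : ‖v‖ ≤ s := by
  refine (PowBound.norm_le h).trans ?_
  rw [mul_assoc, ← exp_add]
  refine mul_le_of_le_one_right hs (exp_le_one_iff.2 ?_)
  nlinarith

namespace PassConstants

variable {D : ℝ → Vec m →L[ℝ] Vec m} {a b c c₁ γ η κ L : ℝ}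

/-- The converse comparison costs the factor `c e^{LT}`, which goes into the gain. -/
theorem gauge_of_norm_le (H : PassConstants D T a b c c₁ γ η κ L) {σ t : ℝ} {v : Vec m}
    (hσ : 0 ≤ σ) (ht : t ∈ Icc 0 T) (hv : ‖v‖ ≤ σ) :
    Gauge D T γ L (c * exp (L * T) * σ) t v := by
  have := PowBound.of_norm_le (H.norm_pow_le t ht) H.γ_pos.le (zero_le_one.trans H.one_le_c) hσ
    H.L_nonneg ht.1 hv
  rw [Gauge, exp_neg]
  convert this using 1
  field_simp

theorem gauge_eq (γ c c₁ L s ξ₀ : ℝ) :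
    ((1 + γ) / 2 * s + c * c₁ * exp (L * T) * ξ₀) * exp (-(L * T)) =
      (1 + γ) / 2 * (s * exp (-(L * T))) + c * c₁ * ξ₀ := by
  rw [exp_neg]
  field_simp

theorem one_le_exp_mul (H : PassConstants D T a b c c₁ γ η κ L) (hT : 0 ≤ T) :
    1 ≤ exp (L * T) := one_le_exp (mul_nonneg H.L_nonneg hT)

theorem small (H : PassConstants D T a b c c₁ γ η κ L) (hT : 0 ≤ T) {s ρ r ξ₀ : ℝ} (hs : 0 ≤ s)
    (hsρ : s ≤ ρ) (hξ : ξ₀ ≤ ρ) (hρr : (κ + 2) * ρ * exp (L * T) < r) :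
    s * exp (-(L * T)) * exp (L * T) ≤ r ∧
      (ξ₀ + κ * (s * exp (-(L * T)))) * exp (L * T) < r := by
  have hκ := H.κ_nonneg
  have h1 := H.one_le_exp_mul hT
  have hρ : 0 ≤ ρ := hs.trans hsρ
  have h2 : s * exp (-(L * T)) * exp (L * T) = s := by rw [mul_assoc, ← exp_add]; simp
  have h3 : ρ ≤ ρ * exp (L * T) := le_mul_of_one_le_right hρ h1
  have h4 : 0 ≤ κ * ρ := by positivity
  have h5 : κ * ρ ≤ κ * ρ * exp (L * T) := le_mul_of_one_le_right h4 h1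
  have h6 : κ * s ≤ κ * ρ := by gcongr
  have h7 : ξ₀ * exp (L * T) ≤ ρ * exp (L * T) := by gcongr
  constructor
  · rw [h2]; nlinarith
  · calc (ξ₀ + κ * (s * exp (-(L * T)))) * exp (L * T)
        = ξ₀ * exp (L * T) + κ * (s * exp (-(L * T)) * exp (L * T)) := by ring
      _ < r := by rw [h2]; nlinarith

end PassConstants

/-- Well-posedness concerns continuously differentiable inputs only, so the gauge also carries this
regularity. It propagates: uniqueness forces every solution to stay in `X`, where `f` and `g` are
smooth enough for state and output to be continuously differentiable again. -/
theorem contracts_drp (hT : 0 ≤ T) (hwp : WellPosed f T X δ)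
    (hf : ContDiffOn ℝ 1 (fun z : Vec n × Vec m × ℝ => f z.1 z.2.1 z.2.2)
      (closure X ×ˢ Y ×ˢ Icc (0 : ℝ) T))
    (hg : ContDiffOn ℝ 1 (fun z : Vec n × Vec m × ℝ => g z.1 z.2.1 z.2.2)
      (closure X ×ˢ Y ×ˢ Icc (0 : ℝ) T)) {D : ℝ → Vec m →L[ℝ] Vec m} {a b c c₁ γ η κ L r ρ : ℝ}
    (H : PassConstants D T a b c c₁ γ η κ L) (hη : 0 ≤ η)
    (hfr : ∀ t ∈ Icc 0 T, ∀ x v, ‖x‖ ≤ r → ‖v‖ ≤ r → ‖f x v t‖ ≤ a * ‖x‖ + b * ‖v‖)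
    (hgr : ∀ t ∈ Icc 0 T, ∀ x v, ‖x‖ ≤ r → ‖v‖ ≤ r → ‖g x v t - D t v‖ ≤ c₁ * ‖x‖ + η * ‖v‖)
    (hrY : Metric.closedBall 0 r ⊆ Y) (hρr : (κ + 2) * ρ * exp (L * T) < r)
    (hρδ : (κ + 2) * ρ * exp (L * T) < δ) :
    Contracts (drp f g T)
      (fun ξ u v => ∃ χ : ℝ → Vec n, χ 0 = ξ ∧ IsCurve f T u χ ∧
        ∀ t ∈ Icc (0 : ℝ) T, v t = g (χ t) (u t) t)
      (fun s u => 0 ≤ s ∧ ContDiffOn ℝ 1 u (Icc 0 T) ∧ ∀ t ∈ Icc 0 T, Gauge D T γ L s t (u t))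
      (c * exp (L * T)) ((1 + γ) / 2) (c * c₁ * exp (L * T)) ρ := by
  have hc := H.one_le_c
  have hc₁ := H.c₁_pos
  have hγ := H.γ_pos
  have hκ := H.κ_nonneg
  have hexp := H.one_le_exp_mul hT
  refine ⟨fun y₀ ξ y => Iff.rfl, fun s u hu => ?_, fun u hu σ hσ hsize => ?_, ?_⟩
  · exact (supNorm_le_ofReal_iff hu.1).2 fun t ht => (hu.2.2 t ht).norm_le H.L_nonneg hu.1 ht.2
  · exact ⟨by positivity, hu, fun t ht =>
      H.gauge_of_norm_le hσ ht ((supNorm_le_ofReal_iff hσ).1 hsize t ht)⟩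
  · rintro ξ s u hs hsρ hξ ⟨-, hu, hus⟩
    obtain ⟨hsr, hr⟩ := H.small hT hs hsρ hξ hρr
    have hunorm : ∀ t ∈ Icc 0 T, ‖u t‖ ≤ s := fun t ht => (hus t ht).norm_le H.L_nonneg hs ht.2
    have hρ : 0 ≤ ρ := hs.trans hsρ
    -- The constant `2` pays for `‖ξ‖ + ‖u‖ ≤ 2ρ < δ`, the smallness required by well-posedness.
    have h2ρ : 2 * ρ ≤ (κ + 2) * ρ * exp (L * T) := by
      have : 2 * ρ ≤ (κ + 2) * ρ := by nlinarith
      exact this.trans (le_mul_of_one_le_right (by positivity) hexp)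
    have huY : MapsTo u (Icc 0 T) Y := fun t ht =>
      hrY (mem_closedBall_zero_iff.2 ((hunorm t ht).trans (by linarith)))
    have hδ : ‖ξ‖ₑ + supNorm T u < ENNReal.ofReal δ := by
      refine lt_of_le_of_lt (add_le_add (b := ENNReal.ofReal ρ) ?_
        ((supNorm_le_ofReal_iff hs).2 hunorm)) ?_
      · rw [← ofReal_norm]; exact ENNReal.ofReal_le_ofReal hξ
      · rw [← ENNReal.ofReal_add hρ hs]
        exact (ENNReal.ofReal_lt_ofReal_iff (by linarith)).2 (by linarith)
    obtain ⟨χ, hχ0, hχ, hχX, huniq⟩ := hwp ξ u hu hδ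
    refine ⟨⟨fun t => g (χ t) (u t) t, χ, hχ0, hχ, fun _ _ => rfl⟩, ?_⟩
    rintro v ⟨χ', hχ'0, hχ', hv⟩
    have heq := huniq χ' hχ'0 hχ'
    have hχ'X : MapsTo χ' (Icc 0 T) X := fun t ht => heq ht ▸ hχX ht
    refine ⟨by positivity, ?_, fun t ht => ?_⟩
    · have h1 := hχ'.contDiffOn hT
        (continuousOn_vectorField hf hχ'.continuousOn hu.continuousOn hχ'X huY)
      exact (contDiffOn_output hg h1 hu hχ'X huY).congr hv
    · rw [Gauge, PassConstants.gauge_eq, hv t ht, ← hχ'0]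
      rw [← hχ'0] at hr
      exact H.curve (by positivity) hη hfr hgr hχ' hus hsr hr t ht

theorem drp_exponentiallyStable (hT : 0 ≤ T) (hf0 : ∀ t ∈ Icc (0 : ℝ) T, f 0 0 t = 0)
    (hg0 : ∀ t ∈ Icc (0 : ℝ) T, g 0 0 t = 0) (hδ : 0 < δ) (hwp : WellPosed f T X δ)
    (hY0 : (0 : Vec m) ∈ interior Y)
    (hf : ContDiffOn ℝ 1 (fun z : Vec n × Vec m × ℝ => f z.1 z.2.1 z.2.2)
      (closure X ×ˢ Y ×ˢ Icc (0 : ℝ) T))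
    (hg : ContDiffOn ℝ 1 (fun z : Vec n × Vec m × ℝ => g z.1 z.2.1 z.2.2)
      (closure X ×ˢ Y ×ˢ Icc (0 : ℝ) T))
    (hF : HasUniformLinearization f T) (hG : HasUniformLinearization g T)
    (hrho : MaxRhoLtOne (partialInput g) T) : (drp f g T).ExponentiallyStable := by
  obtain ⟨c, γ, hc, hγ, hγ1, hD⟩ := exists_uniform_norm_pow_le isCompact_Icc
    hG.continuousOn_partialInput hrho.forall_lt
  obtain ⟨a, b, r₁, ha, hb, hr₁, hfr⟩ := hF.exists_norm_le hf0
  obtain ⟨c₁, hc₁, hgη⟩ := hG.exists_norm_sub_le hg0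
  obtain ⟨κ, L, H⟩ := exists_passConstants hc hγ hγ1 hD ha hb hc₁
  have hη : 0 < (1 - γ) / (4 * c) := by
    have : 0 < 1 - γ := by linarith
    positivity
  obtain ⟨r₂, hr₂, hgr⟩ := hgη _ hη (by
    rw [div_le_one (by positivity)]; linarith)
  obtain ⟨r₃, hr₃, hr₃Y⟩ := Metric.nhds_basis_closedBall.mem_iff.1 (mem_interior_iff_mem_nhds.1 hY0)
  set r := min r₁ (min r₂ r₃)
  have hr : 0 < r := by positivity
  have h1 : r ≤ r₁ := min_le_left _ _
  have h2 : r ≤ r₂ := (min_le_right _ _).trans (min_le_left _ _)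
  have h3 : r ≤ r₃ := (min_le_right _ _).trans (min_le_right _ _)
  have hκ := H.κ_nonneg
  set ρ := min r δ / 2 / ((κ + 2) * exp (L * T))
  have hρ0 : 0 < ρ := by positivity
  have hρ : (κ + 2) * ρ * exp (L * T) = min r δ / 2 := by
    simp only [ρ]; field_simp
  have hmin : 0 < min r δ := by positivity
  have := contracts_drp hT hwp hf hg H hη.le (r := r) (ρ := ρ)
    (fun t ht x v hx hv => hfr t ht x v (hx.trans h1) (hv.trans h1))
    (fun t ht x v hx hv => hgr t ht x v (hx.trans h2) (hv.trans h2))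
    ((Metric.closedBall_subset_closedBall h3).trans hr₃Y)
    (by rw [hρ]; linarith [min_le_left r δ]) (by rw [hρ]; linarith [min_le_right r δ])
  exact this.exponentiallyStable (by positivity) (by linarith) (by positivity)
    (one_le_mul_of_one_le_of_one_le hc (H.one_le_exp_mul hT)) hρ0

end Nonlinear

/-! ### Linear Volterra equations -/

section Volterra

open Filter Set Real MeasureTheory

/-- The map `z ↦ e^{-Lt} (ξ + ∫_0^t (A(s) e^{Ls} z(s) + h(s)) ds)`. -/
noncomputable def volterraMap {E : Type*} [NormedAddCommGroup E] [NormedSpace ℝ E] {T : ℝ}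
    (hT : 0 ≤ T) {A : ℝ → E →L[ℝ] E} (hA : Continuous A) {h : ℝ → E} (hh : Integrable h) (L : ℝ)
    (ξ : E) (z : C(Icc (0 : ℝ) T, E)) : C(Icc (0 : ℝ) T, E) where
  toFun t := exp (-(L * t)) •
    (ξ + ∫ s in (0 : ℝ)..t, (A s (exp (L * s) • IccExtend hT z s) + h s))
  continuous_toFun := by
    have h1 : Continuous (IccExtend hT z) := z.continuous.Icc_extend'
    have h2 : Continuous fun t => ∫ s in (0 : ℝ)..t, (A s (exp (L * s) • IccExtend hT z s) + h s) :=
      intervalIntegral.continuous_primitive (fun a b =>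
        ((hA.clm_apply (by fun_prop)).intervalIntegrable a b).add hh.intervalIntegrable) 0
    have h3 := h2.comp (continuous_subtype_val (p := fun t => t ∈ Icc (0 : ℝ) T))
    simp only [Function.comp_def] at h3
    fun_prop

/-- In the norm weighted by `e^{-Lt}` with `L = 2M`, the integral operator is a contraction of ratio
`1/2` on the whole of `[0,T]`, so the fixed point exists without subdividing the interval. -/
theorem exists_volterra_of_continuous {E : Type*} [NormedAddCommGroup E] [NormedSpace ℝ E]
    [CompleteSpace E] {T : ℝ} (hT : 0 ≤ T) {A : ℝ → E →L[ℝ] E} (hA : Continuous A) {h : ℝ → E}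
    (hh : Integrable h) (ξ : E) :
    ∃ χ : ℝ → E, Continuous χ ∧
      ∀ t ∈ Icc 0 T, χ t = ξ + ∫ s in (0 : ℝ)..t, (A s (χ s) + h s) := by
  obtain ⟨M, hM, hAM⟩ := exists_norm_le_of_continuousOn (T := T) hA.continuousOn
  set L := 2 * M
  have hcontr : ContractingWith (1 / 2) (volterraMap hT hA hh L ξ) := by
    refine ⟨by norm_num, LipschitzWith.of_dist_le_mul fun z w => ?_⟩
    rw [ContinuousMap.dist_le (by positivity)]
    intro t
    have hi : ∀ z : C(Icc (0 : ℝ) T, E), IntervalIntegrable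
        (fun s => A s (exp (L * s) • IccExtend hT z s) + h s) volume 0 t := fun z => by
      have h1 : Continuous (IccExtend hT z) := z.continuous.Icc_extend'
      exact ((hA.clm_apply (by fun_prop)).intervalIntegrable _ _).add hh.intervalIntegrable
    simp only [volterraMap, ContinuousMap.coe_mk, dist_eq_norm]
    rw [← smul_sub, add_sub_add_left_eq_sub, ← intervalIntegral.integral_sub (hi z) (hi w),
      norm_smul, norm_of_nonneg (exp_pos _).le]
    have hint : ∫ s in (0 : ℝ)..t, L * exp (L * s) = exp (L * t) - 1 := by
      rw [intervalIntegral.integral_eq_sub_of_hasDerivAt (f := fun s => exp (L * s))]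
      · simp
      · intro s _
        exact ((hasDerivAt_id s).const_mul L).exp.congr_deriv (by simp; ring)
      · exact (by fun_prop : Continuous fun s => L * exp (L * s)).intervalIntegrable _ _
    have hb : ‖∫ s in (0 : ℝ)..t, ((A s (exp (L * s) • IccExtend hT z s) + h s) -
        (A s (exp (L * s) • IccExtend hT w s) + h s))‖ ≤
        ∫ s in (0 : ℝ)..t, (1 / 2 * ‖z - w‖) * (L * exp (L * s)) := by
      refine intervalIntegral.norm_integral_le_of_norm_le t.2.1 (ae_of_all _ fun s hs => ?_)
        ((by fun_prop : Continuous fun s =>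
          (1 / 2 * ‖z - w‖) * (L * exp (L * s))).intervalIntegrable _ _)
      have hs' : s ∈ Icc 0 T := ⟨hs.1.le, hs.2.trans t.2.2⟩
      rw [add_sub_add_right_eq_sub, ← map_sub, ← smul_sub, IccExtend_of_mem hT _ hs',
        IccExtend_of_mem hT _ hs']
      refine ((A s).le_of_opNorm_le (hAM s hs') _).trans ?_
      rw [norm_smul, norm_of_nonneg (exp_pos _).le]
      have h1 : ‖z ⟨s, hs'⟩ - w ⟨s, hs'⟩‖ ≤ ‖z - w‖ := (z - w).norm_coe_le_norm ⟨s, hs'⟩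
      calc M * (exp (L * s) * ‖z ⟨s, hs'⟩ - w ⟨s, hs'⟩‖) ≤ M * (exp (L * s) * ‖z - w‖) := by gcongr
        _ = _ := by simp only [L]; ring
    rw [intervalIntegral.integral_const_mul, hint] at hb
    calc _ ≤ exp (-(L * t)) * (1 / 2 * ‖z - w‖ * (exp (L * t) - 1)) := by gcongr
      _ = 1 / 2 * ‖z - w‖ * (exp (-(L * t)) * exp (L * t) - exp (-(L * t))) := by ring
      _ ≤ 1 / 2 * ‖z - w‖ * 1 := by
          gcongr
          rw [← exp_add, neg_add_cancel, exp_zero]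
          linarith [exp_pos (-(L * t))]
      _ = _ := by simp
  set z := ContractingWith.fixedPoint _ hcontr
  have hz : volterraMap hT hA hh L ξ z = z := hcontr.fixedPoint_isFixedPt
  have hzc : Continuous (IccExtend hT z) := z.continuous.Icc_extend'
  refine ⟨fun t => exp (L * t) • IccExtend hT z t, by fun_prop, fun t ht => ?_⟩
  have h1 := congrArg (fun q : C(Icc (0 : ℝ) T, E) => q ⟨t, ht⟩) hz
  simp only [volterraMap, ContinuousMap.coe_mk] at h1
  simp only
  rw [IccExtend_of_mem hT _ ht, ← h1, smul_smul, ← exp_add, add_neg_cancel, exp_zero, one_smul]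

/-- `A` is extended continuously and `h` by zero; the equation on `[0,T]` does not see the
extensions. -/
theorem exists_volterra {E : Type*} [NormedAddCommGroup E] [NormedSpace ℝ E]
    [CompleteSpace E] {T : ℝ} (hT : 0 ≤ T) {A : ℝ → E →L[ℝ] E} (hA : ContinuousOn A (Icc 0 T))
    {h : ℝ → E} (hh : Integrable h (timeMeasure T)) (ξ : E) :
    ∃ χ : ℝ → E, ContinuousOn χ (Icc 0 T) ∧
      ∀ t ∈ Icc 0 T, χ t = ξ + ∫ s in (0 : ℝ)..t, (A s (χ s) + h s) := by
  obtain ⟨A', hA'c, hA'⟩ := exists_continuous_eqOn_Icc hT hA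
  obtain ⟨χ, hχ, heq⟩ := exists_volterra_of_continuous hT hA'c
    (h := (Icc 0 T).indicator h) ((integrable_indicator_iff measurableSet_Icc).2 hh) ξ
  refine ⟨χ, hχ.continuousOn, fun t ht => (heq t ht).trans ?_⟩
  congr 1
  refine intervalIntegral.integral_congr fun s hs => ?_
  rw [uIcc_of_le ht.1] at hs
  have hs' : s ∈ Icc 0 T := ⟨hs.1, hs.2.trans ht.2⟩
  simp only [hA' hs', indicator_of_mem hs']

theorem isCurve_of_eq_integral {n m : ℕ} {f : Vec n → Vec m → ℝ → Vec n} {T : ℝ} (hT : 0 ≤ T)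
    {u : ℝ → Vec m} {χ : ℝ → Vec n} {ξ : Vec n}
    (hc : ContinuousOn (fun t => f (χ t) (u t) t) (Icc 0 T))
    (h : ∀ t ∈ Icc 0 T, χ t = ξ + ∫ s in (0 : ℝ)..t, f (χ s) (u s) s) : IsCurve f T u χ := by
  obtain ⟨q, hqc, hq⟩ := exists_continuous_eqOn_Icc hT hc
  intro t ht
  have h1 : HasDerivAt (fun t => ξ + ∫ s in (0 : ℝ)..t, q s) (q t) t :=
    (intervalIntegral.integral_hasDerivAt_right (hqc.intervalIntegrable _ _)
      hqc.aestronglyMeasurable.stronglyMeasurableAtFilter hqc.continuousAt).const_add _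
  have h2 : ∀ t ∈ Icc 0 T, χ t = ξ + ∫ s in (0 : ℝ)..t, q s := fun t ht => by
    refine (h t ht).trans ?_
    congr 1
    refine intervalIntegral.integral_congr fun s hs => ?_
    rw [uIcc_of_le ht.1] at hs
    exact (hq ⟨hs.1, hs.2.trans ht.2⟩).symm
  exact (h1.hasDerivWithinAt.congr h2 (h2 t ht)).congr_deriv (hq ht)

theorem IsCurve.eq_integral {n m : ℕ} {f : Vec n → Vec m → ℝ → Vec n} {T : ℝ}
    {u : ℝ → Vec m} {χ : ℝ → Vec n} (hχ : IsCurve f T u χ)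
    (hc : ContinuousOn (fun t => f (χ t) (u t) t) (Icc 0 T)) :
    ∀ t ∈ Icc 0 T, χ t = χ 0 + ∫ s in (0 : ℝ)..t, f (χ s) (u s) s := by
  intro t ht
  have hsub : Icc 0 t ⊆ Icc 0 T := Icc_subset_Icc_right ht.2
  have h1 := intervalIntegral.integral_eq_sub_of_hasDerivAt_of_le ht.1
    (hχ.continuousOn.mono hsub) (f' := fun s => f (χ s) (u s) s) (fun s hs =>
      (hχ s ⟨hs.1.le, hs.2.le.trans ht.2⟩).hasDerivAt
        (Icc_mem_nhds hs.1 (hs.2.trans_le ht.2)))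
    ((hc.mono (by rwa [uIcc_of_le ht.1])).intervalIntegrable)
  rw [h1]; abel

end Volterra

/-! ### The spectral condition implies global stability of the linear processes -/

section LinearProcess

open Filter Set Real MeasureTheory

instance (T : ℝ) : IsFiniteMeasure (timeMeasure T) := by
  unfold timeMeasure; infer_instance

theorem memLp_clm_apply {n m : ℕ} {A : ℝ → Vec n →L[ℝ] Vec m} {u : ℝ → Vec n} {T : ℝ}
    (hA : ContinuousOn A (Icc 0 T)) (hu : MemLp u ⊤ (timeMeasure T)) :
    MemLp (fun t => A t (u t)) ⊤ (timeMeasure T) := by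
  obtain ⟨C, hC, hAC⟩ := exists_norm_le_of_continuousOn hA
  refine hu.of_le_mul (c := C)
    ((ContinuousLinearMap.id ℝ (Vec n →L[ℝ] Vec m)).aestronglyMeasurable_comp₂
    (hA.aestronglyMeasurable measurableSet_Icc) hu.1) ?_
  exact (ae_restrict_iff' measurableSet_Icc).2 (ae_of_all _ fun t ht =>
    (A t).le_of_opNorm_le (hAC t ht) _)

theorem memLp_of_continuousOn {p : ℕ} {u : ℝ → Vec p} {T : ℝ} (hu : ContinuousOn u (Icc 0 T)) :
    MemLp u ⊤ (timeMeasure T) := by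
  obtain ⟨C, hC, hb⟩ := exists_norm_le_of_continuousOn hu
  exact memLp_top_of_bound (hu.aestronglyMeasurable measurableSet_Icc) C
    ((ae_restrict_iff' measurableSet_Icc).2 (ae_of_all _ hb))

theorem forall_norm_le_of_eLpNorm_le {p : ℕ} {u : ℝ → Vec p} {T σ : ℝ} (hσ : 0 ≤ σ)
    (h : eLpNorm u ⊤ (timeMeasure T) ≤ ENNReal.ofReal σ) : ∀ᵐ t ∂timeMeasure T, ‖u t‖ ≤ σ := by
  rw [eLpNorm_exponent_top] at h
  filter_upwards [ae_le_eLpNormEssSup (f := u) (μ := timeMeasure T)] with t ht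
  have := ht.trans h
  rwa [← ofReal_norm, ENNReal.ofReal_le_ofReal_iff hσ] at this

theorem eLpNorm_le_of_forall_norm_le {p : ℕ} {u : ℝ → Vec p} {T σ : ℝ}
    (h : ∀ᵐ t ∂timeMeasure T, ‖u t‖ ≤ σ) : eLpNorm u ⊤ (timeMeasure T) ≤ ENNReal.ofReal σ := by
  rw [eLpNorm_exponent_top]
  exact eLpNormEssSup_le_of_ae_bound h

variable {n m : ℕ} {T : ℝ} {A : ℝ → Vec n →L[ℝ] Vec n} {B : ℝ → Vec m →L[ℝ] Vec n}
  {C : ℝ → Vec n →L[ℝ] Vec m} {D : ℝ → Vec m →L[ℝ] Vec m}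

theorem continuousOn_linear {p : ℕ} {A : ℝ → Vec n →L[ℝ] Vec p} {B : ℝ → Vec m →L[ℝ] Vec p}
    (hA : ContinuousOn A (Icc 0 T)) (hB : ContinuousOn B (Icc 0 T)) {χ : ℝ → Vec n} {u : ℝ → Vec m}
    (hχ : ContinuousOn χ (Icc 0 T)) (hu : ContinuousOn u (Icc 0 T)) :
    ContinuousOn (fun t => A t (χ t) + B t (u t)) (Icc 0 T) :=
  (hA.clm_apply hχ).add (hB.clm_apply hu)

theorem exists_isCurve_linear (hT : 0 ≤ T) (hA : ContinuousOn A (Icc 0 T))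
    (hB : ContinuousOn B (Icc 0 T)) {u : ℝ → Vec m} (hu : ContinuousOn u (Icc 0 T)) (ξ : Vec n) :
    ∃ χ : ℝ → Vec n, χ 0 = ξ ∧ IsCurve (fun x v t => A t x + B t v) T u χ := by
  obtain ⟨χ, hχ, h⟩ := exists_volterra hT hA (h := fun t => B t (u t))
    ((hB.clm_apply hu).integrableOn_Icc) ξ
  exact ⟨χ, by simpa using h 0 (left_mem_Icc.2 hT),
    isCurve_of_eq_integral hT (continuousOn_linear hA hB hχ hu) h⟩

/-- The bounds on the linear maps are global, so `ρ` is unrestricted. The invariant is continuity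
rather than continuous differentiability, because `C` and `D` are only continuous. -/
theorem contracts_linear_drp (hT : 0 ≤ T) (hA : ContinuousOn A (Icc 0 T))
    (hB : ContinuousOn B (Icc 0 T)) (hC : ContinuousOn C (Icc 0 T)) (hD : ContinuousOn D (Icc 0 T))
    {a b c c₁ γ η κ L ρ : ℝ} (H : PassConstants D T a b c c₁ γ η κ L) (hη : 0 ≤ η)
    (hAa : ∀ t ∈ Icc 0 T, ‖A t‖ ≤ a) (hBb : ∀ t ∈ Icc 0 T, ‖B t‖ ≤ b)
    (hCc : ∀ t ∈ Icc 0 T, ‖C t‖ ≤ c₁) :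
    Contracts (drp (fun x v t => A t x + B t v) (fun x v t => C t x + D t v) T)
      (fun ξ u v => ∃ χ : ℝ → Vec n, χ 0 = ξ ∧ IsCurve (fun x v t => A t x + B t v) T u χ ∧
        ∀ t ∈ Icc (0 : ℝ) T, v t = C t (χ t) + D t (u t))
      (fun s u => 0 ≤ s ∧ ContinuousOn u (Icc 0 T) ∧ ∀ t ∈ Icc 0 T, Gauge D T γ L s t (u t))
      (c * exp (L * T)) ((1 + γ) / 2) (c * c₁ * exp (L * T)) ρ := by
  have hc := H.one_le_c
  have hc₁ := H.c₁_pos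
  have hγ := H.γ_pos
  refine ⟨fun y₀ ξ y => Iff.rfl, fun s u hu => ?_, fun u hu σ hσ hsize => ?_, ?_⟩
  · exact (supNorm_le_ofReal_iff hu.1).2 fun t ht => (hu.2.2 t ht).norm_le H.L_nonneg hu.1 ht.2
  · exact ⟨by positivity, ContDiffOn.continuousOn hu, fun t ht =>
      H.gauge_of_norm_le hσ ht ((supNorm_le_ofReal_iff hσ).1 hsize t ht)⟩
  · rintro ξ s u hs hsρ hξ ⟨-, hu, hus⟩
    -- The radius is an arbitrary number beyond the reach of the pass.
    obtain ⟨hsr, hr⟩ := H.small hT hs hsρ hξ (lt_add_one _)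
    obtain ⟨χ, hχ0, hχ⟩ := exists_isCurve_linear hT hA hB hu ξ
    refine ⟨⟨fun t => C t (χ t) + D t (u t), χ, hχ0, hχ, fun _ _ => rfl⟩, ?_⟩
    rintro v ⟨χ', hχ'0, hχ', hv⟩
    refine ⟨by positivity,
      (continuousOn_linear hC hD hχ'.continuousOn hu).congr hv, fun t ht => ?_⟩
    rw [Gauge, PassConstants.gauge_eq, hv t ht, ← hχ'0]
    rw [← hχ'0] at hr
    refine H.curve (g := fun x v t => C t x + D t v) (by positivity) hη ?_ ?_ hχ' hus hsr hr t ht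
    · intro t ht x v _ _
      exact (norm_add_le _ _).trans (add_le_add ((A t).le_of_opNorm_le (hAa t ht) x)
        ((B t).le_of_opNorm_le (hBb t ht) v))
    · intro t ht x v _ _
      rw [add_sub_cancel_right]
      exact ((C t).le_of_opNorm_le (hCc t ht) x).trans (le_add_of_nonneg_right (by positivity))

theorem norm_le_of_linear_integral (hT : 0 ≤ T) {a b c c₁ γ η κ L s : ℝ}
    (H : PassConstants D T a b c c₁ γ η κ L)
    (hAa : ∀ t ∈ Icc 0 T, ‖A t‖ ≤ a) (hBb : ∀ t ∈ Icc 0 T, ‖B t‖ ≤ b) (hs : 0 ≤ s)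
    {u : ℝ → Vec m} {χ : ℝ → Vec n} {ξ : Vec n}
    (hu : ∀ᵐ t ∂timeMeasure T, PowBound D γ L s t (u t)) (hχ : ContinuousOn χ (Icc 0 T))
    (h : ∀ t ∈ Icc 0 T, χ t = ξ + ∫ x in (0 : ℝ)..t, (A x (χ x) + B x (u x))) :
    ∀ t ∈ Icc 0 T, ‖χ t‖ ≤ (‖ξ‖ + κ * s) * exp (L * t) := by
  refine norm_le_exp_of_le_integral H.a_nonneg H.b_nonneg hs hT H.a_lt_L H.b_le H.L_nonneg
    (norm_nonneg _) hχ fun t ht => ?_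
  rw [h t ht]
  refine (norm_add_le _ _).trans (add_le_add le_rfl ?_)
  have hu' := (ae_restrict_iff' measurableSet_Icc).1 hu
  refine intervalIntegral.norm_integral_le_of_norm_le ht.1 ?_ ?_
  · filter_upwards [hu'] with x hx hxt
    have hx' : x ∈ Icc 0 T := ⟨hxt.1.le, hxt.2.trans ht.2⟩
    have hb := H.b_nonneg
    refine (norm_add_le _ _).trans (add_le_add ((A x).le_of_opNorm_le (hAa x hx') _)
      (((B x).le_of_opNorm_le (hBb x hx') _).trans ?_))
    gcongr
    exact (hx hx').norm_le
  · refine ContinuousOn.intervalIntegrable ?_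
    rw [uIcc_of_le ht.1]
    have := (hχ.mono (Icc_subset_Icc_right ht.2)).norm
    fun_prop

/-- The state is an integral, hence bounded at every time by an almost everywhere bound on the
input; the output estimate is then pointwise off a null set. -/
theorem contracts_linftyDrp (hT : 0 ≤ T) (hA : ContinuousOn A (Icc 0 T))
    (hB : ContinuousOn B (Icc 0 T)) (hC : ContinuousOn C (Icc 0 T)) (hD : ContinuousOn D (Icc 0 T))
    {a b c c₁ γ η κ L ρ : ℝ} (H : PassConstants D T a b c c₁ γ η κ L) (hη : 0 ≤ η)
    (hAa : ∀ t ∈ Icc 0 T, ‖A t‖ ≤ a) (hBb : ∀ t ∈ Icc 0 T, ‖B t‖ ≤ b)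
    (hCc : ∀ t ∈ Icc 0 T, ‖C t‖ ≤ c₁) :
    Contracts (linftyDrp A B C D T)
      (fun ξ u v => MemLp u ⊤ (timeMeasure T) ∧ ∃ χ : ℝ → Vec n, ContinuousOn χ (Icc 0 T) ∧
        (∀ t ∈ Icc (0 : ℝ) T, χ t = ξ + ∫ s in (0 : ℝ)..t, (A s (χ s) + B s (u s))) ∧
        ∀ᵐ t ∂(timeMeasure T), v t = C t (χ t) + D t (u t))
      (fun s u => 0 ≤ s ∧ MemLp u ⊤ (timeMeasure T) ∧
        ∀ᵐ t ∂timeMeasure T, Gauge D T γ L s t (u t))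
      (c * exp (L * T)) ((1 + γ) / 2) (c * c₁ * exp (L * T)) ρ := by
  have hc := H.one_le_c
  have hc₁ := H.c₁_pos
  have hγ := H.γ_pos
  have hmem : ∀ᵐ t ∂timeMeasure T, t ∈ Icc 0 T := ae_restrict_mem measurableSet_Icc
  refine ⟨fun y₀ ξ y => Iff.rfl, fun s u hu => ?_, fun u hu σ hσ hsize => ?_, ?_⟩
  · refine eLpNorm_le_of_forall_norm_le ?_
    filter_upwards [hu.2.2, hmem] with t h1 ht
    exact h1.norm_le H.L_nonneg hu.1 ht.2
  · refine ⟨by positivity, hu, ?_⟩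
    filter_upwards [forall_norm_le_of_eLpNorm_le hσ hsize, hmem] with t h1 ht
    exact H.gauge_of_norm_le hσ ht h1
  · rintro ξ s u hs - - ⟨-, hu, hus⟩
    obtain ⟨χ, hχ, h⟩ := exists_volterra hT hA (h := fun t => B t (u t))
      ((memLp_clm_apply hB hu).integrable le_top) ξ
    refine ⟨⟨fun t => C t (χ t) + D t (u t), hu, χ, hχ, h, ae_of_all _ fun _ => rfl⟩, ?_⟩
    rintro v ⟨-, χ', hχ', h', hv⟩
    refine ⟨by positivity, ?_, ?_⟩
    · exact ((memLp_clm_apply hC (memLp_of_continuousOn hχ')).add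
        (memLp_clm_apply hD hu)).ae_eq (hv.mono fun t ht => ht.symm)
    · have hb := norm_le_of_linear_integral hT H hAa hBb (by positivity) hus hχ' h'
      filter_upwards [hus, hv, hmem] with t h1 h2 ht
      rw [Gauge, PassConstants.gauge_eq, h2]
      refine H.output ht (by positivity) hη h1 (hb t ht) ?_
      rw [add_sub_cancel_right]
      exact ((C t).le_of_opNorm_le (hCc t ht) _).trans (le_add_of_nonneg_right (by positivity))

theorem exists_passConstants_linear (hA : ContinuousOn A (Icc 0 T))
    (hB : ContinuousOn B (Icc 0 T)) (hC : ContinuousOn C (Icc 0 T)) (hD : ContinuousOn D (Icc 0 T))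
    (hrho : MaxRhoLtOne D T) : ∃ a b c c₁ γ η κ L : ℝ, PassConstants D T a b c c₁ γ η κ L ∧ 0 ≤ η ∧
      (∀ t ∈ Icc 0 T, ‖A t‖ ≤ a) ∧ (∀ t ∈ Icc 0 T, ‖B t‖ ≤ b) ∧ ∀ t ∈ Icc 0 T, ‖C t‖ ≤ c₁ := by
  obtain ⟨c, γ, hc, hγ, hγ1, hDp⟩ := exists_uniform_norm_pow_le isCompact_Icc hD hrho.forall_lt
  obtain ⟨a, ha, hAa⟩ := exists_norm_le_of_continuousOn hA
  obtain ⟨b, hb, hBb⟩ := exists_norm_le_of_continuousOn hB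
  obtain ⟨c₁, hc₁, hCc⟩ := exists_norm_le_of_continuousOn hC
  obtain ⟨κ, L, H⟩ := exists_passConstants hc hγ hγ1 hDp ha.le hb.le hc₁
  have : 0 < 1 - γ := by linarith
  exact ⟨a, b, c, c₁, γ, _, κ, L, H, by positivity, hAa, hBb, hCc⟩

theorem linear_drp_globallyExponentiallyStable (hT : 0 ≤ T) (hA : ContinuousOn A (Icc 0 T))
    (hB : ContinuousOn B (Icc 0 T)) (hC : ContinuousOn C (Icc 0 T)) (hD : ContinuousOn D (Icc 0 T))
    (hrho : MaxRhoLtOne D T) :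
    (drp (fun x v t => A t x + B t v) (fun x v t => C t x + D t v)
      T).GloballyExponentiallyStable := by
  obtain ⟨a, b, c, c₁, γ, η, κ, L, H, hη, hAa, hBb, hCc⟩ :=
    exists_passConstants_linear hA hB hC hD hrho
  have hc := H.one_le_c
  have hc₁ := H.c₁_pos
  have hγ := H.γ_pos
  have hγ1 := H.γ_lt_one
  exact Contracts.globallyExponentiallyStable
    (fun _ _ => contracts_linear_drp hT hA hB hC hD H hη hAa hBb hCc) (by positivity)
    (by linarith) (by positivity) (one_le_mul_of_one_le_of_one_le hc (H.one_le_exp_mul hT))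

theorem linftyDrp_globallyExponentiallyStable (hT : 0 ≤ T) (hA : ContinuousOn A (Icc 0 T))
    (hB : ContinuousOn B (Icc 0 T)) (hC : ContinuousOn C (Icc 0 T)) (hD : ContinuousOn D (Icc 0 T))
    (hrho : MaxRhoLtOne D T) : (linftyDrp A B C D T).GloballyExponentiallyStable := by
  obtain ⟨a, b, c, c₁, γ, η, κ, L, H, hη, hAa, hBb, hCc⟩ :=
    exists_passConstants_linear hA hB hC hD hrho
  have hc := H.one_le_c
  have hc₁ := H.c₁_pos
  have hγ := H.γ_pos
  have hγ1 := H.γ_lt_one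
  exact Contracts.globallyExponentiallyStable
    (fun _ _ => contracts_linftyDrp hT hA hB hC hD H hη hAa hBb hCc) (by positivity)
    (by linarith) (by positivity) (one_le_mul_of_one_le_of_one_le hc (H.one_le_exp_mul hT))

end LinearProcess

/-! ### Decay with zero initial states forces the spectral condition -/

section Necessity

open Filter Set Real MeasureTheory

variable {n m : ℕ} {T : ℝ} {f : Vec n → Vec m → ℝ → Vec n} {g : Vec n → Vec m → ℝ → Vec m}

/-- Passes with zero initial states do not enlarge the weight of the signal, and for small `τ`
they are close to multiplication by `D(t)`. -/
theorem norm_sub_pow_apply_le {D : ℝ → Vec m →L[ℝ] Vec m} {a b c₁ d L r s τ : ℝ} (hb : 0 ≤ b)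
    (hc₁ : 0 ≤ c₁) (hd : 0 ≤ d) (hs : 0 ≤ s) (hτ : 0 ≤ τ) (hτ1 : τ ≤ 1) (haL : a < L)
    (hbL : b ≤ (L - a) * τ) (hL : 0 ≤ L)
    (hf : ∀ t ∈ Icc 0 T, ∀ x v, ‖x‖ ≤ r → ‖v‖ ≤ r → ‖f x v t‖ ≤ a * ‖x‖ + b * ‖v‖)
    (hg : ∀ t ∈ Icc 0 T, ∀ x v, ‖x‖ ≤ r → ‖v‖ ≤ r → ‖g x v t - D t v‖ ≤ c₁ * ‖x‖ + τ * ‖v‖)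
    (hD : ∀ t ∈ Icc 0 T, ‖D t‖ ≤ d) {y : ℕ → ℝ → Vec m}
    (hy : ∀ k, ∃ χ : ℝ → Vec n, χ 0 = 0 ∧ IsCurve f T (y k) χ ∧
      ∀ t ∈ Icc (0 : ℝ) T, y (k + 1) t = g (χ t) (y k t) t)
    (hy0 : ∀ t ∈ Icc 0 T, ‖y 0 t‖ ≤ s * exp (L * t)) (k : ℕ)
    (hsmall : s * (d + c₁ + 1) ^ k * exp (L * T) < r) :
    ∀ t ∈ Icc 0 T, ‖y k t‖ ≤ s * (d + c₁ + 1) ^ k * exp (L * t) ∧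
      ‖y k t - (D t ^ k) (y 0 t)‖ ≤ k * (τ * (s * (d + c₁ + 1) ^ k * exp (L * t))) := by
  -- The growth of one pass: `d` from `D(t)`, `c₁` from the state and `1` from the remainder, both
  -- of the latter even multiplied by `τ ≤ 1`.
  set Q := d + c₁ + 1 with hQ
  have hQ1 : 1 ≤ Q := by linarith
  induction k with
  | zero => intro t ht; simpa using hy0 t ht
  | succ k ih =>
    have hpow : s * Q ^ k * exp (L * T) ≤ s * Q ^ (k + 1) * exp (L * T) := by
      gcongr
      omega
    have hsk : s * Q ^ k * exp (L * T) < r := hpow.trans_lt hsmall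
    have hσ : 0 ≤ s * Q ^ k := by positivity
    obtain ⟨χ, hχ0, hχ, hyk⟩ := hy k
    have hχn := hχ.norm_le hb hσ haL hbL hL hf (fun t ht => (ih hsk t ht).1) hsk.le (by
      rw [hχ0, norm_zero, zero_add]
      refine lt_of_le_of_lt ?_ hsk
      exact mul_le_mul_of_nonneg_right (mul_le_of_le_one_left hσ hτ1) (exp_pos _).le)
    intro t ht
    obtain ⟨ih1, ih2⟩ := ih hsk t ht
    have hx := hχn t ht
    rw [hχ0, norm_zero, zero_add] at hx
    have hle : exp (L * t) ≤ exp (L * T) := exp_le_exp.2 (mul_le_mul_of_nonneg_left ht.2 hL)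
    set w := s * Q ^ k * exp (L * t) with hw
    have hw0 : 0 ≤ w := by positivity
    have hwr : w ≤ r := (mul_le_mul_of_nonneg_left hle hσ).trans hsk.le
    have hx' : ‖χ t‖ ≤ τ * w := hx.trans_eq (by rw [hw]; ring)
    have hxw : τ * w ≤ w := mul_le_of_le_one_left hw0 hτ1
    have hstep : ‖y (k + 1) t - D t (y k t)‖ ≤ (c₁ + 1) * (τ * w) := by
      rw [hyk t ht]
      refine (hg t ht _ _ (hx'.trans (hxw.trans hwr)) (ih1.trans hwr)).trans ?_
      calc c₁ * ‖χ t‖ + τ * ‖y k t‖ ≤ c₁ * (τ * w) + τ * w := by gcongr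
        _ = _ := by ring
    have hwQ : s * Q ^ (k + 1) * exp (L * t) = Q * w := by rw [hw]; ring
    rw [hwQ]
    constructor
    · calc ‖y (k + 1) t‖ = ‖(y (k + 1) t - D t (y k t)) + D t (y k t)‖ := by rw [sub_add_cancel]
        _ ≤ (c₁ + 1) * (τ * w) + d * w := (norm_add_le _ _).trans
            (add_le_add hstep (((D t).le_of_opNorm_le (hD t ht) _).trans (by gcongr)))
        _ ≤ (c₁ + 1) * w + d * w := by gcongr
        _ = Q * w := by rw [hQ]; ring
    -- The new error of this pass plus the propagated old error; since each is at most `Q` times its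
    -- bound, the errors add up to the factor `k + 1`.
    · have hdec : y (k + 1) t - (D t ^ (k + 1)) (y 0 t) =
          (y (k + 1) t - D t (y k t)) + D t (y k t - (D t ^ k) (y 0 t)) := by
        rw [map_sub, pow_succ', mul_apply_eq_comp]; abel
      have hτw : 0 ≤ τ * w := by positivity
      rw [hdec]
      calc _ ≤ (c₁ + 1) * (τ * w) + d * (k * (τ * w)) := (norm_add_le _ _).trans
            (add_le_add hstep (((D t).le_of_opNorm_le (hD t ht) _).trans (by gcongr)))
        _ ≤ Q * (τ * w) + Q * (k * (τ * w)) := by gcongr <;> linarith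
        _ = _ := by push_cast; ring

/-- All small smooth initial outputs, with zero initial states, have an output sequence that decays
at the rate `γ`. -/
def ZeroStateDecay (f : Vec n → Vec m → ℝ → Vec n) (g : Vec n → Vec m → ℝ → Vec m)
    (T K γ δ : ℝ) : Prop :=
  ∀ y₀ : ℝ → Vec m, ContDiff ℝ 1 y₀ → (∀ t ∈ Icc 0 T, ‖y₀ t‖ ≤ δ) →
    ∃ y : ℕ → ℝ → Vec m, y 0 = y₀ ∧
      (∀ k, ∃ χ : ℝ → Vec n, χ 0 = 0 ∧ IsCurve f T (y k) χ ∧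
        ∀ t ∈ Icc (0 : ℝ) T, y (k + 1) t = g (χ t) (y k t) t) ∧
      ∀ σ : ℝ, 0 ≤ σ → (∀ t ∈ Icc 0 T, ‖y₀ t‖ ≤ σ) →
        ∀ k, ∀ t ∈ Icc 0 T, ‖y k t‖ ≤ K * γ ^ k * σ

/-- For each small `τ`, a peaked input at `t₀` whose weight matches `e^{Lt}` makes `y_k(t₀)` equal
to `ε D(t₀)^k v` up to an error `O(τ ε)`. Comparing with the assumed decay, dividing by `ε` and
letting `τ` tend to `0` gives the bound. -/
theorem ZeroStateDecay.norm_pow_le {K γ δ : ℝ} (h : ZeroStateDecay f g T K γ δ) (hδ : 0 < δ)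
    (hK : 0 ≤ K) (hγ : 0 ≤ γ) (hF : HasUniformLinearization f T) (hG : HasUniformLinearization g T)
    (hf0 : ∀ t ∈ Icc (0 : ℝ) T, f 0 0 t = 0) (hg0 : ∀ t ∈ Icc (0 : ℝ) T, g 0 0 t = 0) {t₀ : ℝ}
    (ht₀ : t₀ ∈ Icc 0 T) (k : ℕ) : ‖partialInput g t₀ ^ k‖ ≤ K * γ ^ k := by
  refine ContinuousLinearMap.opNorm_le_bound _ (by positivity) fun v => ?_
  obtain ⟨a, b, r₁, ha, hb, hr₁, hfr⟩ := hF.exists_norm_le hf0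
  obtain ⟨c₁, hc₁, hgη⟩ := hG.exists_norm_sub_le hg0
  obtain ⟨d, hd, hDd⟩ := exists_norm_le_of_continuousOn hG.continuousOn_partialInput
  set Q := d + c₁ + 1
  have key : ∀ τ : ℝ, 0 < τ → τ ≤ 1 →
      ‖(partialInput g t₀ ^ k) v‖ ≤ K * γ ^ k * ‖v‖ + τ * (k * (2 * ‖v‖ * Q ^ k)) := by
    intro τ hτ hτ1
    obtain ⟨r₂, hr₂, hgr⟩ := hgη τ hτ hτ1
    set r := min r₁ r₂
    have hr : 0 < r := by positivity
    set L := a + b / τ + 1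
    have hbτ : 0 ≤ b / τ := by positivity
    have hbτ' : b / τ * τ = b := div_mul_cancel₀ _ hτ.ne'
    have hL : 0 ≤ L := by positivity
    set M := 2 * exp (-(L * t₀)) * Q ^ k * exp (L * T)
    -- Small enough for the decay hypothesis and for all `k` passes to remain within radius `r`; the
    -- denominator allows `v = 0`.
    set ε := min δ (r / (2 * M)) / (‖v‖ + 1)
    have hM : 0 < M := by positivity
    have hε : 0 < ε := by positivity
    have hεv : ε * ‖v‖ ≤ min δ (r / (2 * M)) := by
      calc ε * ‖v‖ ≤ ε * (‖v‖ + 1) := by gcongr; linarith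
        _ = _ := div_mul_cancel₀ _ (by positivity)
    -- A smooth signal with two bounds: its norm is at most its value `ε ‖v‖` at `t₀`, and at most
    -- `2 ε ‖v‖ e^{L(t - t₀)}`, which is the weight of the pass estimates.
    set y₀ : ℝ → Vec m := fun t => (ε / cosh (L * (t - t₀))) • v
    have hcosh : ∀ t, ‖y₀ t‖ = ε * ‖v‖ / cosh (L * (t - t₀)) := fun t => by
      have := cosh_pos (L * (t - t₀))
      simp only [y₀]
      rw [norm_smul, norm_of_nonneg (by positivity)]; ring
    have hy₀1 : ∀ t, ‖y₀ t‖ ≤ ε * ‖v‖ := fun t => by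
      rw [hcosh]; exact div_le_self (by positivity) (one_le_cosh _)
    have hy₀2 : ∀ t, ‖y₀ t‖ ≤ 2 * (ε * ‖v‖) * exp (-(L * t₀)) * exp (L * t) := fun t => by
      have h1 : exp (-(L * (t - t₀))) ≤ 2 * cosh (L * (t - t₀)) := by
        rw [cosh_eq]; linarith [exp_pos (L * (t - t₀))]
      rw [hcosh, div_le_iff₀ (cosh_pos _), mul_assoc _ (exp _) (exp _), ← exp_add,
        show -(L * t₀) + L * t = L * (t - t₀) by ring]
      calc ε * ‖v‖ = ε * ‖v‖ * (exp (L * (t - t₀)) * exp (-(L * (t - t₀)))) := by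
            rw [← exp_add, add_neg_cancel, exp_zero, mul_one]
        _ ≤ ε * ‖v‖ * (exp (L * (t - t₀)) * (2 * cosh (L * (t - t₀)))) := by gcongr
        _ = _ := by ring
    have hsmooth : ContDiff ℝ 1 y₀ :=
      (contDiff_const.div (contDiff_cosh.comp (by fun_prop)) fun t => (cosh_pos _).ne').smul
        contDiff_const
    obtain ⟨y, hy0, hy, hdecay⟩ := h y₀ hsmooth
      (fun t _ => (hy₀1 t).trans (hεv.trans (min_le_left _ _)))
    have hsm : 2 * (ε * ‖v‖) * exp (-(L * t₀)) * Q ^ k * exp (L * T) < r := by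
      calc _ = ε * ‖v‖ * M := by simp only [M]; ring
        _ ≤ r / (2 * M) * M := by gcongr; exact hεv.trans (min_le_right _ _)
        _ = r / 2 := by field_simp
        _ < r := by linarith
    have h1 := (norm_sub_pow_apply_le (f := f) (g := g) (D := partialInput g) (a := a) hb hc₁.le
      hd.le (by positivity) hτ.le hτ1 (by simp only [L]; linarith) (by simp only [L]; nlinarith) hL
      (fun t ht x v hx hv => hfr t ht x v (hx.trans (min_le_left _ _)) (hv.trans (min_le_left _ _)))
      (fun t ht x v hx hv => hgr t ht x v (hx.trans (min_le_right _ _))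
        (hv.trans (min_le_right _ _))) hDd hy (fun t _ => by rw [hy0]; exact hy₀2 t) k hsm
      t₀ ht₀).2
    have h2 := hdecay (ε * ‖v‖) (by positivity) (fun t _ => hy₀1 t) k t₀ ht₀
    have h3 : y 0 t₀ = ε • v := by rw [hy0]; simp [y₀]
    have h5 : exp (-(L * t₀)) * exp (L * t₀) = 1 := by rw [← exp_add]; simp
    rw [h3, map_smul] at h1
    have h4 := norm_le_norm_add_norm_sub (y k t₀) (ε • (partialInput g t₀ ^ k) v)
    rw [norm_smul, norm_of_nonneg hε.le] at h4
    -- Both bounds are proportional to `ε`, so it cancels although it depends on `τ`.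
    have h6 : ε * ‖(partialInput g t₀ ^ k) v‖ ≤
        ε * (K * γ ^ k * ‖v‖ + τ * (k * (2 * ‖v‖ * Q ^ k))) := by
      calc _ ≤ K * γ ^ k * (ε * ‖v‖) +
          k * (τ * (2 * (ε * ‖v‖) * exp (-(L * t₀)) * Q ^ k * exp (L * t₀))) :=
            h4.trans (add_le_add h2 h1)
        _ = ε * (K * γ ^ k * ‖v‖ +
          τ * (k * (2 * ‖v‖ * Q ^ k)) * (exp (-(L * t₀)) * exp (L * t₀))) := by ring
        _ = _ := by rw [h5, mul_one]
    exact le_of_mul_le_mul_left h6 hε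
  have hlim : Tendsto (fun τ : ℝ => K * γ ^ k * ‖v‖ + τ * (k * (2 * ‖v‖ * Q ^ k))) (𝓝[>] 0)
      (𝓝 (K * γ ^ k * ‖v‖ + 0 * (k * (2 * ‖v‖ * Q ^ k)))) :=
    ((by fun_prop : Continuous fun τ : ℝ =>
      K * γ ^ k * ‖v‖ + τ * (k * (2 * ‖v‖ * Q ^ k))).tendsto 0).mono_left nhdsWithin_le_nhds
  rw [zero_mul, add_zero] at hlim
  refine ge_of_tendsto hlim ?_
  filter_upwards [Ioo_mem_nhdsGT one_pos] with τ hτ using key τ hτ.1 hτ.2.le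

theorem ZeroStateDecay.maxRhoLtOne {K γ δ : ℝ} (h : ZeroStateDecay f g T K γ δ) (hT : 0 ≤ T)
    (hδ : 0 < δ) (hK : 0 ≤ K) (hγ : 0 ≤ γ) (hγ1 : γ < 1) (hF : HasUniformLinearization f T)
    (hG : HasUniformLinearization g T) (hf0 : ∀ t ∈ Icc (0 : ℝ) T, f 0 0 t = 0)
    (hg0 : ∀ t ∈ Icc (0 : ℝ) T, g 0 0 t = 0) : MaxRhoLtOne (partialInput g) T :=
  maxRhoLtOne_of_forall_lt hT hG.continuousOn_partialInput fun _ ht =>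
    (rho_le_of_norm_pow_le hγ fun k => h.norm_pow_le hδ hK hγ hF hG hf0 hg0 ht k).trans_lt
      (ENNReal.ofReal_lt_one.2 hγ1)

end Necessity

/-! ### From the stability notions to decay with zero initial states -/

section Equivalence

open Filter Set Real MeasureTheory

variable {n m : ℕ} {T : ℝ}

theorem expNorm_zero {p : ℕ} (lam : ℝ) : expNorm lam (0 : ℕ → Vec p) = 0 := by
  simp [expNorm]

/-- With zero initial states the exponential norm vanishes for every `lam`, so the value `1/2` is an
arbitrary choice; halving `δ` turns a weak inequality into the strict one required. -/
theorem zeroStateDecay_of_expBoundWithin {f : Vec n → Vec m → ℝ → Vec n}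
    {g : Vec n → Vec m → ℝ → Vec m} {K γ : ℝ → ℝ} {δ : ℝ} (hδ : 0 < δ)
    (hKγ : RepProcess.IsGainRate K γ)
    (h : (drp f g T).zeroInitial.ExpBoundWithin K γ δ) :
    ZeroStateDecay f g T (K (1 / 2)) (γ (1 / 2)) (δ / 2) := by
  have hhalf : (1 / 2 : ℝ) ∈ Ioo (0 : ℝ) 1 := by constructor <;> norm_num
  have hK : (0 : ℝ) ≤ K (1 / 2) := zero_le_one.trans (hKγ.1 hhalf)
  have hγ : 0 ≤ γ (1 / 2) := (hKγ.2.2.2.1 hhalf).1.le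
  intro y₀ hy₀ hsmall
  have hlt : supNorm T y₀ + expNorm (1 / 2) (0 : ℕ → Vec n) < ENNReal.ofReal δ := by
    rw [expNorm_zero, add_zero]
    exact ((supNorm_le_ofReal_iff (by positivity)).2 hsmall).trans_lt
      ((ENNReal.ofReal_lt_ofReal_iff hδ).2 (by linarith))
  obtain ⟨⟨y, hy⟩, hall⟩ := h (1 / 2) hhalf y₀ hy₀.contDiffOn 0 ⟨mem_univ _, rfl⟩ hlt
  refine ⟨y, hy.1, fun k => hy.2 k, fun σ hσ hb k => ?_⟩
  refine (supNorm_le_ofReal_iff (by positivity)).1 ?_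
  refine (hall y hy k).trans ?_
  rw [expNorm_zero, add_zero, ENNReal.ofReal_mul (p := K (1 / 2) * γ (1 / 2) ^ k) (by positivity)]
  exact mul_le_mul' le_rfl ((supNorm_le_ofReal_iff hσ).2 hb)

variable {A : ℝ → Vec n →L[ℝ] Vec n} {B : ℝ → Vec m →L[ℝ] Vec n}
  {C : ℝ → Vec n →L[ℝ] Vec m} {D : ℝ → Vec m →L[ℝ] Vec m}

theorem partialState_linear {p : ℕ} (A : ℝ → Vec n →L[ℝ] Vec p) (B : ℝ → Vec m →L[ℝ] Vec p) :
    partialState (fun x v t => A t x + B t v) = A := by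
  ext1 t
  simp only [partialState, map_zero, add_zero]
  exact (A t).fderiv

theorem partialInput_linear {p : ℕ} (A : ℝ → Vec n →L[ℝ] Vec p) (B : ℝ → Vec m →L[ℝ] Vec p) :
    partialInput (fun x v t => A t x + B t v) = B := by
  ext1 t
  simp only [partialInput, map_zero, zero_add]
  exact (B t).fderiv

theorem hasUniformLinearization_linear {p : ℕ} {A : ℝ → Vec n →L[ℝ] Vec p}
    {B : ℝ → Vec m →L[ℝ] Vec p} (hA : ContinuousOn A (Icc 0 T)) (hB : ContinuousOn B (Icc 0 T)) :
    HasUniformLinearization (fun x v t => A t x + B t v) T := by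
  refine ⟨by rwa [partialState_linear], by rwa [partialInput_linear], fun η hη =>
    ⟨1, one_pos, fun t _ x u _ _ => ?_⟩⟩
  rw [partialState_linear, partialInput_linear]
  simp only [map_zero, add_zero, sub_zero, sub_self, norm_zero]
  positivity

theorem ZeroStateDecay.maxRhoLtOne_linear {K γ δ : ℝ}
    (h : ZeroStateDecay (fun x v t => A t x + B t v) (fun x v t => C t x + D t v) T K γ δ)
    (hT : 0 ≤ T) (hδ : 0 < δ) (hK : 0 ≤ K) (hγ : 0 ≤ γ) (hγ1 : γ < 1)
    (hA : ContinuousOn A (Icc 0 T)) (hB : ContinuousOn B (Icc 0 T)) (hC : ContinuousOn C (Icc 0 T))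
    (hD : ContinuousOn D (Icc 0 T)) : MaxRhoLtOne D T := by
  have := h.maxRhoLtOne hT hδ hK hγ hγ1 (hasUniformLinearization_linear hA hB)
    (hasUniformLinearization_linear hC hD) (by simp) (by simp)
  rwa [partialInput_linear] at this

/-- Continuous functions equal almost everywhere on a nondegenerate interval are equal there. For `T
= 0` the time measure is zero and the claim fails. -/
theorem forall_norm_le_of_ae {p : ℕ} {u : ℝ → Vec p} {σ : ℝ} (hT : 0 < T)
    (hu : ContinuousOn u (Icc 0 T)) (h : ∀ᵐ t ∂timeMeasure T, ‖u t‖ ≤ σ) :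
    ∀ t ∈ Icc 0 T, ‖u t‖ ≤ σ := by
  have h1 : EqOn (fun t => max ‖u t‖ σ) (fun _ => σ) (Icc 0 T) :=
    Measure.eqOn_Icc_of_ae_eq volume hT.ne (h.mono fun t ht => max_eq_right ht)
      (hu.norm.sup continuousOn_const) continuousOn_const
  exact fun t ht => (le_max_left _ _).trans_eq (h1 ht)

/-- The classical continuous output sequence of a smooth input is also an `L^∞` output sequence, so
the essential bound applies to it, and continuity makes the bound pointwise. -/
theorem zeroStateDecay_of_linfty_expBoundWithin {K γ : ℝ → ℝ} {δ : ℝ} (hT : 0 < T) (hδ : 0 < δ)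
    (hKγ : RepProcess.IsGainRate K γ)
    (hA : ContinuousOn A (Icc 0 T)) (hB : ContinuousOn B (Icc 0 T)) (hC : ContinuousOn C (Icc 0 T))
    (hD : ContinuousOn D (Icc 0 T)) (h : (linftyDrp A B C D T).zeroInitial.ExpBoundWithin K γ δ) :
    ZeroStateDecay (fun x v t => A t x + B t v) (fun x v t => C t x + D t v) T
      (K (1 / 2)) (γ (1 / 2)) (δ / 2) := by
  have hhalf : (1 / 2 : ℝ) ∈ Ioo (0 : ℝ) 1 := by constructor <;> norm_num
  have hK : (0 : ℝ) ≤ K (1 / 2) := zero_le_one.trans (hKγ.1 hhalf)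
  have hγ : 0 ≤ γ (1 / 2) := (hKγ.2.2.2.1 hhalf).1.le
  have hmem : ∀ᵐ t ∂timeMeasure T, t ∈ Icc 0 T := ae_restrict_mem measurableSet_Icc
  have hsize : ∀ (u : ℝ → Vec m) (σ : ℝ), (∀ t ∈ Icc 0 T, ‖u t‖ ≤ σ) →
      eLpNorm u ⊤ (timeMeasure T) ≤ ENNReal.ofReal σ := fun u σ hb =>
    eLpNorm_le_of_forall_norm_le (hmem.mono hb)
  intro y₀ hy₀ hsmall
  obtain ⟨⟨y, hy0, hy⟩, hcont⟩ := exists_seq_and_forall_of_step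
    (R := fun _ u v => ∃ χ : ℝ → Vec n, χ 0 = 0 ∧ IsCurve (fun x v t => A t x + B t v) T u χ ∧
      ∀ t ∈ Icc (0 : ℝ) T, v t = C t (χ t) + D t (u t))
    (I := fun _ u => ContinuousOn u (Icc 0 T)) (y₀ := y₀) hy₀.continuous.continuousOn
    (fun k u hu => by
      obtain ⟨χ, hχ0, hχ⟩ := exists_isCurve_linear hT.le hA hB hu 0
      refine ⟨⟨_, χ, hχ0, hχ, fun _ _ => rfl⟩, ?_⟩
      rintro v ⟨χ', -, hχ', hv⟩
      exact (continuousOn_linear hC hD hχ'.continuousOn hu).congr hv)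
  have hyc := hcont y hy0 hy
  have hlt : eLpNorm y₀ ⊤ (timeMeasure T) + expNorm (1 / 2) (0 : ℕ → Vec n) <
      ENNReal.ofReal δ := by
    rw [expNorm_zero, add_zero]
    exact (hsize y₀ _ hsmall).trans_lt ((ENNReal.ofReal_lt_ofReal_iff hδ).2 (by linarith))
  have hout : (linftyDrp A B C D T).zeroInitial.IsOutput y₀ 0 y := by
    refine ⟨hy0, fun k => ⟨memLp_of_continuousOn (hyc k), ?_⟩⟩
    obtain ⟨χ, hχ0, hχ, hv⟩ := hy k
    refine ⟨χ, hχ.continuousOn, fun t ht => ?_, hmem.mono hv⟩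
    rw [Pi.zero_apply, ← hχ0]
    exact hχ.eq_integral (continuousOn_linear hA hB hχ.continuousOn (hyc k)) t ht
  have hall := (h (1 / 2) hhalf y₀ (memLp_of_continuousOn hy₀.continuous.continuousOn) 0
    ⟨mem_univ _, rfl⟩ hlt).2 y hout
  refine ⟨y, hy0, hy, fun σ hσ hb k => forall_norm_le_of_ae hT (hyc k) ?_⟩
  refine forall_norm_le_of_eLpNorm_le (by positivity) ((hall k).trans ?_)
  rw [expNorm_zero, add_zero, ENNReal.ofReal_mul (p := K (1 / 2) * γ (1 / 2) ^ k) (by positivity)]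
  exact mul_le_mul' le_rfl (hsize y₀ σ hb)

theorem linear_drp_maxRhoLtOne (hT : 0 ≤ T) (hA : ContinuousOn A (Icc 0 T))
    (hB : ContinuousOn B (Icc 0 T)) (hC : ContinuousOn C (Icc 0 T)) (hD : ContinuousOn D (Icc 0 T))
    (h : (drp (fun x v t => A t x + B t v) (fun x v t => C t x + D t v)
      T).zeroInitial.GloballyExponentiallyStable) : MaxRhoLtOne D T := by
  obtain ⟨-, K, γ, hKγ, hb⟩ := h
  have hhalf : (1 / 2 : ℝ) ∈ Ioo (0 : ℝ) 1 := by constructor <;> norm_num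
  exact (zeroStateDecay_of_expBoundWithin one_pos hKγ (hb 1 one_pos)).maxRhoLtOne_linear hT
    (by norm_num) (zero_le_one.trans (hKγ.1 hhalf)) (hKγ.2.2.2.1 hhalf).1.le
    (hKγ.2.2.2.1 hhalf).2 hA hB hC hD

theorem linftyDrp_maxRhoLtOne (hT : 0 < T) (hA : ContinuousOn A (Icc 0 T))
    (hB : ContinuousOn B (Icc 0 T)) (hC : ContinuousOn C (Icc 0 T)) (hD : ContinuousOn D (Icc 0 T))
    (h : (linftyDrp A B C D T).zeroInitial.GloballyExponentiallyStable) : MaxRhoLtOne D T := by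
  obtain ⟨-, K, γ, hKγ, hb⟩ := h
  have hhalf : (1 / 2 : ℝ) ∈ Ioo (0 : ℝ) 1 := by constructor <;> norm_num
  exact (zeroStateDecay_of_linfty_expBoundWithin hT one_pos hKγ hA hB hC hD
    (hb 1 one_pos)).maxRhoLtOne_linear hT.le
    (by norm_num) (zero_le_one.trans (hKγ.1 hhalf)) (hKγ.2.2.2.1 hhalf).1.le
    (hKγ.2.2.2.1 hhalf).2 hA hB hC hD

theorem drp_maxRhoLtOne {f : Vec n → Vec m → ℝ → Vec n} {g : Vec n → Vec m → ℝ → Vec m}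
    (hT : 0 ≤ T) (hF : HasUniformLinearization f T)
    (hG : HasUniformLinearization g T) (hf0 : ∀ t ∈ Icc (0 : ℝ) T, f 0 0 t = 0)
    (hg0 : ∀ t ∈ Icc (0 : ℝ) T, g 0 0 t = 0) (h : (drp f g T).zeroInitial.ExponentiallyStable) :
    MaxRhoLtOne (partialInput g) T := by
  obtain ⟨-, δ, hδ, K, γ, hKγ, hb⟩ := h
  have hhalf : (1 / 2 : ℝ) ∈ Ioo (0 : ℝ) 1 := by constructor <;> norm_num
  exact (zeroStateDecay_of_expBoundWithin hδ hKγ hb).maxRhoLtOne hT (by positivity)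
    (zero_le_one.trans (hKγ.1 hhalf)) (hKγ.2.2.2.1 hhalf).1.le (hKγ.2.2.2.1 hhalf).2 hF hG hf0 hg0

end Equivalence

end DRP

/-! ### The equivalences -/

theorem mainTheorem1 {n m : ℕ} (T : ℝ) (hT : 0 ≤ T)
    (f : DRP.Vec n → DRP.Vec m → ℝ → DRP.Vec n)
    (g : DRP.Vec n → DRP.Vec m → ℝ → DRP.Vec m)
    (hf0 : ∀ t ∈ Set.Icc (0 : ℝ) T, f 0 0 t = 0)
    (hg0 : ∀ t ∈ Set.Icc (0 : ℝ) T, g 0 0 t = 0)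
    (X : Set (DRP.Vec n)) (hXo : IsOpen X) (hXb : Bornology.IsBounded X) (hXc : IsConnected X)
    (δ : ℝ) (hδ : 0 < δ)
    (hsol : ∀ (ξ : DRP.Vec n) (u : ℝ → DRP.Vec m), ContDiffOn ℝ 1 u (Set.Icc 0 T) →
      ‖ξ‖ₑ + DRP.supNorm T u < ENNReal.ofReal δ →
        ∃ χ : ℝ → DRP.Vec n, χ 0 = ξ ∧ DRP.IsCurve f T u χ ∧ Set.MapsTo χ (Set.Icc 0 T) X ∧
          ∀ χ' : ℝ → DRP.Vec n, χ' 0 = ξ → DRP.IsCurve f T u χ' →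
            Set.EqOn χ' χ (Set.Icc 0 T))
    (Y : Set (DRP.Vec m)) (hYc : IsCompact Y) (hY0 : (0 : DRP.Vec m) ∈ interior Y)
    (hf : ContDiffOn ℝ 1 (fun z : DRP.Vec n × DRP.Vec m × ℝ => f z.1 z.2.1 z.2.2)
      (closure X ×ˢ Y ×ˢ Set.Icc (0 : ℝ) T))
    (hg : ContDiffOn ℝ 1 (fun z : DRP.Vec n × DRP.Vec m × ℝ => g z.1 z.2.1 z.2.2)
      (closure X ×ˢ Y ×ˢ Set.Icc (0 : ℝ) T)) :
    [(DRP.drp f g T).ExponentiallyStable,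
      (DRP.drp f g T).zeroInitial.ExponentiallyStable,
      (DRP.linearization f g T).GloballyExponentiallyStable,
      (DRP.linearization f g T).zeroInitial.GloballyExponentiallyStable,
      DRP.MaxRhoLtOne (DRP.partialInput g) T].TFAE ∧
    (0 < T →
      [(DRP.drp f g T).ExponentiallyStable,
        (DRP.drp f g T).zeroInitial.ExponentiallyStable,
        (DRP.linftyLinearization f g T).GloballyExponentiallyStable,
        (DRP.linftyLinearization f g T).zeroInitial.GloballyExponentiallyStable,
        DRP.MaxRhoLtOne (DRP.partialInput g) T].TFAE) := by
  have h0X : 0 ∈ X := DRP.WellPosed.zero_mem hsol hT hδ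
  -- Passing to open sets of states and inputs makes the partial derivatives at the origin genuine.
  have hsub : X ×ˢ interior Y ×ˢ Set.Icc (0 : ℝ) T ⊆ closure X ×ˢ Y ×ˢ Set.Icc (0 : ℝ) T :=
    Set.prod_mono subset_closure (Set.prod_mono interior_subset le_rfl)
  have hF := DRP.hasUniformLinearization hT hXo h0X isOpen_interior hY0 (hf.mono hsub)
  have hG := DRP.hasUniformLinearization hT hXo h0X isOpen_interior hY0 (hg.mono hsub)
  have h51 : DRP.MaxRhoLtOne (DRP.partialInput g) T → (DRP.drp f g T).ExponentiallyStable :=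
    DRP.drp_exponentiallyStable hT hf0 hg0 hδ hsol hY0 hf hg hF hG
  have h12 : (DRP.drp f g T).ExponentiallyStable →
      (DRP.drp f g T).zeroInitial.ExponentiallyStable :=
    fun h => h.zeroInitial
  have h25 : (DRP.drp f g T).zeroInitial.ExponentiallyStable →
      DRP.MaxRhoLtOne (DRP.partialInput g) T := DRP.drp_maxRhoLtOne hT hF hG hf0 hg0
  refine ⟨?_, fun hT0 => ?_⟩
  · tfae_have 1 → 2 := h12
    tfae_have 2 → 5 := h25
    tfae_have 5 → 1 := h51
    tfae_have 5 → 3 := DRP.linear_drp_globallyExponentiallyStable hT hF.1 hF.2 hG.1 hG.2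
    tfae_have 3 → 4 := fun h => h.zeroInitial
    tfae_have 4 → 5 := DRP.linear_drp_maxRhoLtOne hT hF.1 hF.2 hG.1 hG.2
    tfae_finish
  · tfae_have 1 → 2 := h12
    tfae_have 2 → 5 := h25
    tfae_have 5 → 1 := h51
    tfae_have 5 → 3 := DRP.linftyDrp_globallyExponentiallyStable hT hF.1 hF.2 hG.1 hG.2
    tfae_have 3 → 4 := fun h => h.zeroInitial
    tfae_have 4 → 5 := DRP.linftyDrp_maxRhoLtOne hT0 hF.1 hF.2 hG.1 hG.2
    tfae_finish
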